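/- Let $\mathbb K$ be an algebraically closed field (of any characteristic), let $I\subset\mathbb K[x_1,\dots,x_n]$ be an ideal and $V(I)\subset\mathbb K^n$ its zero set. For $\omega\in\mathbb R^n$ and a polynomial $f$ let $\mathrm{In}_\omega f$ be the sum of the terms $a_\mu x^\mu$ of $f$ (with $a_\mu\ne0$) for which $\omega\cdot\mu$ is minimal, and let $\mathfrak{In}_\omega I=\langle \mathrm{In}_\omega f: f\in I\rangle$. The tropical variety of $I$ is $\mathbf{TV}(I)=\{\omega\in\mathbb R^n:\mathfrak{In}_\omega I\text{ contains no monomial}\}$. Put $C_\omega(I)=\overline{\{u\in\mathbb R^n:\mathfrak{In}_uI=\mathfrak{In}_\omega I\}}$ (closure in $\mathbb R^n$) and, for $J\subset\{1,\dots,n\}$, let $E_J$ be the cone generated by the standard basis vectors $e^{(j)}$, $j\in J$. The Gröbner fan of $I$ is $\Sigma(I)=\{C_\omega(I)\cap E_J:\omega\in\mathbb R^n,\ J\subset\{1,\dots,n\}\}$. Let $\Sigma$ be a regular refinement of $\Sigma(I)$, that is, a finite fan with support in $(\mathbb R_{\ge0})^n$, each of whose cones is regular (generated by a $\mathbb Z$-basis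 of the group of integer points of its linear span), and such that every member of $\Sigma(I)$ is a union of cones of $\Sigma$. For a unimodular integer matrix $N$ let $\phi_N$ be the rational map of $\mathbb K^n$ whose $i$-th coordinate is the Laurent monomial with exponent the $i$-th column of $N$. The toric variety $X_\Sigma$ is obtained from copies $U_\sigma$ of $\mathbb K^n$, one for each $n$-dimensional cone $\sigma=\mathrm{Cone}(M)\in\Sigma$ (generated by the columns of $M\in GL(n,\mathbb Z)$), by identifying $u\in U_{\mathrm{Cone}(M)}$ with $u'\in U_{\mathrm{Cone}(M')}$ whenever $\phi_{M^t(M'^{-1})^t}$ is biregular at $u$ and sends $u$ to $u'$. The toric modification $\pi:X_\Sigma\to\mathbb K^n$ is given by $\phi_{M^t}$ on $U_{\mathrm{Cone}(M)}$. The strict transform of $V(I)$ is the Zariski closure $$\widetilde{V(I)}=\overline{\pi^{-1}\bigl(\{x\in V(I): x_1\cdots x_n\neq0\}\bigr)}\subset X_\Sigma .$$ If $\tau\in\Sigma$ is generated by the columns of $M$ with index in $\lambda\subset\{1,\dots,n\}$, where $\mathrm{Cone}(M)\in\Sigma$ is $n$-dimensional, the orbit of $\tau$ is $\mathcal O(\tau)=\{x\in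 U_{\mathrm{Cone}(M)}: x_i=0\Leftrightarrow i\in\lambda\}\subset X_\Sigma$. Then, for every $\tau\in\Sigma$, $$\widetilde{V(I)}\cap\mathcal O(\tau)\neq\emptyset\iff\tau\subset\mathbf{TV}(I).$$ -/

import Mathlib

open scoped Matrix

noncomputable section

namespace ToricTropical

/-! ### Cones and fans -/

/-- The polyhedral cone generated by a finite family of vectors. -/
def coneGen {n : ℕ} {ι : Type} [Fintype ι] (u : ι → Fin n → ℝ) : Set (Fin n → ℝ) :=
  {x | ∃ c : ι → ℝ, (∀ i, 0 ≤ c i) ∧ x = ∑ i, c i • u i}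

/-- An integer vector, seen as a real vector. -/
def toReal {n : ℕ} (v : Fin n → ℤ) : Fin n → ℝ := fun i => (v i : ℝ)

/-- The first orthant of `ℝⁿ`. -/
def orthant (n : ℕ) : Set (Fin n → ℝ) := {x | ∀ i, 0 ≤ x i}

/-- The cone `E_J` generated by the standard basis vectors `e⁽ʲ⁾`, `j ∈ J`. -/
def coordCone {n : ℕ} (J : Finset (Fin n)) : Set (Fin n → ℝ) :=
  coneGen fun j : J => (Pi.single (j : Fin n) 1 : Fin n → ℝ)

/-- The dual of a cone. -/
def dualCone {n : ℕ} (σ : Set (Fin n → ℝ)) : Set (Fin n → ℝ) :=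
  {v | ∀ x ∈ σ, 0 ≤ v ⬝ᵥ x}

/-- `τ` is a face of the cone `σ`: it is cut out by a supporting hyperplane
(`v = 0` gives `σ` itself). -/
def IsFace {n : ℕ} (τ σ : Set (Fin n → ℝ)) : Prop :=
  ∃ v ∈ dualCone σ, τ = {x ∈ σ | v ⬝ᵥ x = 0}

/-- A regular cone: it is generated by integer vectors that form a `ℤ`-basis of the group of
integer points in the linear span of the cone. -/
def IsRegularCone {n : ℕ} (σ : Set (Fin n → ℝ)) : Prop :=
  ∃ (k : ℕ) (u : Fin k → Fin n → ℤ),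
    σ = coneGen (fun i => toReal (u i)) ∧
    LinearIndependent ℤ u ∧
    ∀ v : Fin n → ℤ, toReal v ∈ Submodule.span ℝ σ ↔ v ∈ Submodule.span ℤ (Set.range u)

/-- A (finite) regular polyhedral fan in `ℝⁿ` with support in the first orthant. -/
structure RegularFan (n : ℕ) where
  /-- the cones of the fan -/
  cones : Set (Set (Fin n → ℝ))
  finite : cones.Finite
  regular : ∀ σ ∈ cones, IsRegularCone σ
  face_mem : ∀ σ ∈ cones, ∀ τ, IsFace τ σ → τ ∈ cones
  inter_face : ∀ σ ∈ cones, ∀ τ ∈ cones, IsFace (σ ∩ τ) σ ∧ IsFace (σ ∩ τ) τ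
  subset_orthant : ∀ σ ∈ cones, σ ⊆ orthant n

/-- `F'` refines `F`: every cone of `F` is a union of cones of `F'`. -/
def IsRefinement {n : ℕ} (F' F : Set (Set (Fin n → ℝ))) : Prop :=
  ∀ σ ∈ F, ∃ S ⊆ F', σ = ⋃₀ S

/-! ### Initial ideals, the Gröbner fan and the tropical variety -/

section Initial

variable {K : Type*} [Field K] {n : ℕ}

/-- The scalar product `ω · μ` of a weight vector and an exponent. -/
def weight (ω : Fin n → ℝ) (μ : Fin n →₀ ℕ) : ℝ := ∑ i, ω i * (μ i : ℝ)

open Classical in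
/-- The `ω`-initial part of `f`: the sum of the terms of `f` of minimal `ω`-weight. -/
def initialForm (ω : Fin n → ℝ) (f : MvPolynomial (Fin n) K) : MvPolynomial (Fin n) K :=
  ∑ μ ∈ f.support.filter (fun μ => ∀ μ' ∈ f.support, weight ω μ ≤ weight ω μ'),
    MvPolynomial.monomial μ (f.coeff μ)

/-- The `ω`-initial ideal of `I`. -/
def initialIdeal (ω : Fin n → ℝ) (I : Ideal (MvPolynomial (Fin n) K)) :
    Ideal (MvPolynomial (Fin n) K) :=
  Ideal.span (initialForm ω '' (I : Set (MvPolynomial (Fin n) K)))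

/-- `C_ω(I)`: the closure in `ℝⁿ` of the set of weights with the same initial ideal as `ω`. -/
def groebnerCone (I : Ideal (MvPolynomial (Fin n) K)) (ω : Fin n → ℝ) : Set (Fin n → ℝ) :=
  closure {u | initialIdeal u I = initialIdeal ω I}

/-- The Gröbner fan of `I`: the intersections of the `C_ω(I)` with the faces of the first
orthant. -/
def groebnerFan (I : Ideal (MvPolynomial (Fin n) K)) : Set (Set (Fin n → ℝ)) :=
  {σ | ∃ (ω : Fin n → ℝ) (J : Finset (Fin n)), σ = groebnerCone I ω ∩ coordCone J}

/-- The tropical variety of `I`: the weights whose initial ideal contains no monomial. -/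
def tropicalVariety (I : Ideal (MvPolynomial (Fin n) K)) : Set (Fin n → ℝ) :=
  {ω | ∀ μ : Fin n →₀ ℕ, MvPolynomial.monomial μ (1 : K) ∉ initialIdeal ω I}

end Initial

/-! ### Monomial transformations -/

section Monomial

variable {K : Type*} [Field K] {n : ℕ}

/-- The monomial map `φ_N`; its `i`-th coordinate is the Laurent monomial whose exponent is the
`i`-th column of `N`. Its value is meaningful at the points where it is regular. -/
def monomialMap (N : Matrix (Fin n) (Fin n) ℤ) (x : Fin n → K) : Fin n → K :=
  fun i => ∏ j, x j ^ N j i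

/-- The rational map `φ_N` is regular at `x`: no coordinate that vanishes at `x` occurs in a
denominator of `φ_N`. -/
def RegularAt (N : Matrix (Fin n) (Fin n) ℤ) (x : Fin n → K) : Prop :=
  ∀ i j, N j i < 0 → x j ≠ 0

theorem regularAt_mul {N N' : Matrix (Fin n) (Fin n) ℤ} {x : Fin n → K}
    (h : RegularAt N x) (h' : RegularAt N' (monomialMap N x)) :
    RegularAt (N * N') x := by
  intro i j hneg hx
  rw [Matrix.mul_apply] at hneg
  refine absurd hneg (not_lt.mpr (Finset.sum_nonneg fun k _ => ?_))
  have h0 : 0 ≤ N j k := not_lt.mp fun hlt => h k j hlt hx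
  rcases h0.eq_or_lt with h0 | h0
  · simp [← h0]
  · have : monomialMap N x k = 0 :=
      Finset.prod_eq_zero (Finset.mem_univ j) (by rw [hx, zero_zpow _ h0.ne'])
    exact mul_nonneg h0.le (not_lt.mp fun hlt => h' i k hlt this)

theorem monomialMap_mul {N N' : Matrix (Fin n) (Fin n) ℤ} {x : Fin n → K}
    (h : RegularAt N x) (h' : RegularAt N' (monomialMap N x)) :
    monomialMap N' (monomialMap N x) = monomialMap (N * N') x := by
  funext i
  have key : ∀ j, ∏ k, (x j ^ N j k) ^ N' k i = x j ^ (N * N') j i := by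
    intro j
    rw [Matrix.mul_apply]
    by_cases hx : x j = 0
    · have hN : ∀ k, 0 ≤ N j k := fun k => not_lt.mp fun hlt => h k j hlt hx
      have hN' : ∀ k, 0 < N j k → 0 ≤ N' k i := fun k hk => by
        have : monomialMap N x k = 0 :=
          Finset.prod_eq_zero (Finset.mem_univ j) (by rw [hx, zero_zpow _ hk.ne'])
        exact not_lt.mp fun hlt => h' i k hlt this
      have hnn : ∀ k, 0 ≤ N j k * N' k i := fun k => by
        rcases (hN k).eq_or_lt with h0 | h0
        · simp [← h0]
        · exact mul_nonneg h0.le (hN' k h0)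
      simp_rw [← zpow_mul, hx]
      by_cases hs : ∑ k, N j k * N' k i = 0
      · have hz := (Finset.sum_eq_zero_iff_of_nonneg fun k _ => hnn k).mp hs
        rw [hs, zpow_zero]
        exact Finset.prod_eq_one fun k hk => by rw [hz k hk, zpow_zero]
      · rw [zero_zpow _ hs]
        obtain ⟨k, hk, hne⟩ := Finset.exists_ne_zero_of_sum_ne_zero hs
        exact Finset.prod_eq_zero hk (zero_zpow _ hne)
    · simp_rw [← zpow_mul]
      induction (Finset.univ : Finset (Fin n)) using Finset.induction_on with
      | empty => simp
      | insert a s ha ih =>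
        rw [Finset.prod_insert ha, Finset.sum_insert ha, zpow_add₀ hx, ih]
  simp only [monomialMap, ← Finset.prod_zpow]
  rw [Finset.prod_comm]
  exact Finset.prod_congr rfl fun j _ => key j

theorem monomialMap_one (x : Fin n → K) : monomialMap 1 x = x := by
  funext i
  rw [monomialMap, Finset.prod_eq_single i]
  · simp
  · intro j _ hj
    simp [Matrix.one_apply_ne hj]
  · simp

theorem regularAt_of_nonneg {N : Matrix (Fin n) (Fin n) ℤ} (hN : ∀ i j, 0 ≤ N i j)
    (x : Fin n → K) : RegularAt N x :=
  fun i j hlt => absurd (hN j i) (not_le.mpr hlt)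

end Monomial

/-! ### The toric variety of a regular fan and its toric modification -/

section Toric

variable {n : ℕ}

/-- The `j`-th column of `M`, as a real vector. -/
def column (M : GL (Fin n) ℤ) (j : Fin n) : Fin n → ℝ := toReal fun i => M.val i j

/-- The unimodular matrices `M` with `Cone(M)` in the fan. They index the charts; a cone of
maximal dimension occurs once for each ordering of its vertices, and the corresponding charts
are identified with each other by the gluing. -/
def MaxCone (F : RegularFan n) : Type :=
  {M : GL (Fin n) ℤ // coneGen (column M) ∈ F.cones}

/-- The exponent matrix `Mᵗ(M'⁻¹)ᵗ` of the change of charts from `M` to `M'`. -/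
def transition (M M' : GL (Fin n) ℤ) : Matrix (Fin n) (Fin n) ℤ :=
  M.valᵀ * (M'⁻¹).valᵀ

theorem transition_self (M : GL (Fin n) ℤ) : transition M M = 1 := by
  rw [transition, ← Matrix.transpose_mul, Units.inv_mul, Matrix.transpose_one]

theorem transition_mul_transpose (M M' : GL (Fin n) ℤ) :
    transition M M' * M'.valᵀ = M.valᵀ := by
  rw [transition, Matrix.mul_assoc, ← Matrix.transpose_mul, Units.mul_inv,
    Matrix.transpose_one, Matrix.mul_one]

theorem transition_mul (M M' M'' : GL (Fin n) ℤ) :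
    transition M M' * transition M' M'' = transition M M'' := by
  conv_lhs => rw [transition.eq_def M' M'', ← Matrix.mul_assoc, transition_mul_transpose]
  rfl

variable (K : Type*) [Field K]

/-- The disjoint union of the affine charts. -/
abbrev ChartPoint (F : RegularFan n) : Type _ := MaxCone F × (Fin n → K)

variable {K}

/-- The gluing relation: the change of charts is biregular at the first point (it is regular
there and its inverse is regular at the image) and maps it to the second one. -/
def Glue {F : RegularFan n} (p q : ChartPoint K F) : Prop :=
  RegularAt (transition p.1.1 q.1.1) p.2 ∧
  RegularAt (transition q.1.1 p.1.1) (monomialMap (transition p.1.1 q.1.1) p.2) ∧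
  monomialMap (transition p.1.1 q.1.1) p.2 = q.2

theorem glue_refl {F : RegularFan n} (p : ChartPoint K F) : Glue p p := by
  have h : ∀ x : Fin n → K, RegularAt (1 : Matrix (Fin n) (Fin n) ℤ) x := fun x =>
    regularAt_of_nonneg (fun i j => by by_cases hij : i = j <;> simp [Matrix.one_apply, hij]) x
  refine ⟨?_, ?_, ?_⟩ <;> rw [transition_self]
  · exact h _
  · exact h _
  · exact monomialMap_one _

theorem glue_symm {F : RegularFan n} {p q : ChartPoint K F} (h : Glue p q) : Glue q p := by
  obtain ⟨h1, h2, h3⟩ := h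
  have h4 : monomialMap (transition q.1.1 p.1.1) q.2 = p.2 := by
    rw [← h3, monomialMap_mul h1 h2, transition_mul, transition_self, monomialMap_one]
  rw [h3] at h2
  exact ⟨h2, by rw [h4]; exact h1, h4⟩

theorem glue_trans {F : RegularFan n} {p q r : ChartPoint K F} (h : Glue p q) (h' : Glue q r) :
    Glue p r := by
  have aux : ∀ {p q r : ChartPoint K F}, Glue p q → Glue q r →
      RegularAt (transition p.1.1 r.1.1) p.2 ∧
        monomialMap (transition p.1.1 r.1.1) p.2 = r.2 := by
    rintro p q r ⟨h1, -, h3⟩ ⟨k1, -, k3⟩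
    rw [← h3] at k1 k3
    refine ⟨?_, ?_⟩
    · rw [← transition_mul _ q.1.1]
      exact regularAt_mul h1 k1
    · rw [← transition_mul _ q.1.1, ← monomialMap_mul h1 k1, k3]
  obtain ⟨h1, h2⟩ := aux h h'
  obtain ⟨k1, -⟩ := aux (glue_symm h') (glue_symm h)
  exact ⟨h1, by rw [h2]; exact k1, h2⟩

/-- The gluing relation as an equivalence relation. -/
def glueSetoid (K : Type*) [Field K] (F : RegularFan n) : Setoid (ChartPoint K F) where
  r := Glue
  iseqv := ⟨glue_refl, glue_symm, glue_trans⟩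

/-- The (`K`-points of the) toric variety `X_Σ`. -/
def ToricVariety (K : Type*) [Field K] (F : RegularFan n) : Type _ :=
  Quotient (glueSetoid K F)

/-- The inclusion of the chart `U_σ`, `σ = Cone(M)`. -/
def chart (K : Type*) [Field K] {F : RegularFan n} (M : MaxCone F) (x : Fin n → K) :
    ToricVariety K F :=
  Quotient.mk (glueSetoid K F) (M, x)

theorem column_mem (M : GL (Fin n) ℤ) (j : Fin n) : column M j ∈ coneGen (column M) :=
  ⟨Pi.single j 1, fun i => by by_cases h : i = j <;> simp [h], by
    simp [Pi.single_apply]⟩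

theorem MaxCone.nonneg {F : RegularFan n} (M : MaxCone F) (i j : Fin n) :
    0 ≤ M.1.val i j := by
  have h := F.subset_orthant _ M.2 (column_mem M.1 j) i
  simp only [column, toReal] at h
  exact_mod_cast h

/-- The toric modification `π : X_Σ → Kⁿ`, given on the chart of `Cone(M)` by `φ_{Mᵗ}`. -/
def toricModification (F : RegularFan n) : ToricVariety K F → (Fin n → K) :=
  Quotient.lift (fun p : ChartPoint K F => monomialMap p.1.1.valᵀ p.2) (by
    rintro p q ⟨h1, -, h3⟩
    have hq : RegularAt q.1.1.valᵀ (monomialMap (transition p.1.1 q.1.1) p.2) :=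
      regularAt_of_nonneg (fun i j => q.1.nonneg j i) _
    change monomialMap p.1.1.valᵀ p.2 = monomialMap q.1.1.valᵀ q.2
    rw [← h3, monomialMap_mul h1 hq, transition_mul_transpose])

/-- Zariski closed subsets of `X_Σ`: the trace on each affine chart is an algebraic set. -/
def IsZariskiClosed {F : RegularFan n} (Z : Set (ToricVariety K F)) : Prop :=
  ∀ M : MaxCone F, ∃ S : Set (MvPolynomial (Fin n) K),
    chart K M ⁻¹' Z = {x | ∀ p ∈ S, MvPolynomial.eval x p = 0}

/-- The Zariski closure in `X_Σ`. -/
def zariskiClosure {F : RegularFan n} (A : Set (ToricVariety K F)) : Set (ToricVariety K F) :=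
  ⋂₀ {Z | IsZariskiClosed Z ∧ A ⊆ Z}

/-- The strict transform of `V ⊆ Kⁿ`: the Zariski closure of the preimage of the set of points
of `V` outside the coordinate hyperplanes. -/
def strictTransform (F : RegularFan n) (V : Set (Fin n → K)) : Set (ToricVariety K F) :=
  zariskiClosure (toricModification F ⁻¹' {x ∈ V | ∀ i, x i ≠ 0})

/-- The orbit of a cone `τ`: if `τ` is generated by the columns of `M` with index in `s`, where
`Cone(M)` is in the fan, it consists of the points of the chart of `Cone(M)` whose vanishing
coordinates are exactly those with index in `s`. -/
def orbit (K : Type*) [Field K] (F : RegularFan n) (τ : Set (Fin n → ℝ)) :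
    Set (ToricVariety K F) :=
  {y | ∃ (M : MaxCone F) (s : Finset (Fin n)) (x : Fin n → K),
    τ = coneGen (fun j : s => column M.1 j) ∧ (∀ i, x i = 0 ↔ i ∈ s) ∧ y = chart K M x}

end Toric

end ToricTropical

end

noncomputable section

namespace ToricTropical

/-! ### Leading monomials and initial ideals -/

section Leading

variable {K : Type*} [Field K] {n : ℕ}

/-! In the chart of `Cone(M)` the strict transform is the zero set of J, the vanishing ideal of the
part of V(I) in the torus (`chart_mem_strictTransform_iff`). The argument relates zeros of J on a
coordinate stratum to leading monomials: ω lies outside TV(I) exactly when some element of I has a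
single term of minimal ω-weight (`notMem_tropicalVariety_iff`), and such elements can be carried
between I and J by monomial substitution.

Suppose x is a zero of J whose vanishing coordinates are those in s. The local ring at x need not
have dimension one, so a prime Q is chosen with J ≤ Q ≤ m, maximal among those that omit the product
h of the coordinates (`exists_prime_forall_pow_mem`). It plays the role of a curve through x that is
not contained in the coordinate hyperplanes. A valuation with support Q and centre m may have higher
rank, but the choice of Q makes the values of the vanishing coordinates mutually archimedean, and
Hahn–Banach turns them into real weights c, positive exactly on s (`exists_real_weight`). An element
of J has value 0, whereas one with a leading monomial for c has the nonzero value of that monomial.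
Hence the combination of the columns of M with coefficients c, a relatively interior point of τ, is
in TV(I). As Σ refines the Gröbner fan and TV(I) is closed, all of τ follows
(`coneGen_subset_tropicalVariety`).

Conversely, if the strict transform misses the orbit, the Nullstellensatz yields an element of J of
the form monomial in the nonvanishing coordinates minus terms divisible by some X_i with i in s
(`exists_hasLeadingMonomial_of_disjoint`). It has a leading monomial for the indicator weight of s.
Carried back to V(I), with a second use of the Nullstellensatz, it shows that the sum of the
generators of τ is not in TV(I). -/

theorem weight_add (ω : Fin n → ℝ) (μ ν : Fin n →₀ ℕ) :
    weight ω (μ + ν) = weight ω μ + weight ω ν := by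
  simp [weight, mul_add, Finset.sum_add_distrib]

theorem continuous_weight (μ : Fin n →₀ ℕ) : Continuous fun ω : Fin n → ℝ => weight ω μ := by
  unfold weight
  fun_prop

/-- `μ` is the only exponent of `f` of minimal `ω`-weight. -/
def HasLeadingMonomial (ω : Fin n → ℝ) (f : MvPolynomial (Fin n) K) (μ : Fin n →₀ ℕ) : Prop :=
  f.coeff μ ≠ 0 ∧ ∀ ν ∈ f.support, ν ≠ μ → weight ω μ < weight ω ν

theorem hasLeadingMonomial_monomial (ω : Fin n → ℝ) (μ : Fin n →₀ ℕ) {c : K} (hc : c ≠ 0) :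
    HasLeadingMonomial ω (MvPolynomial.monomial μ c) μ := by
  refine ⟨by simpa using hc, fun ν hν hne => absurd ?_ hne⟩
  simpa using MvPolynomial.support_monomial_subset hν

theorem HasLeadingMonomial.le {ω : Fin n → ℝ} {f : MvPolynomial (Fin n) K} {μ ν : Fin n →₀ ℕ}
    (h : HasLeadingMonomial ω f μ) (hν : ν ∈ f.support) : weight ω μ ≤ weight ω ν := by
  by_cases hne : ν = μ
  · rw [hne]
  · exact (h.2 ν hν hne).le

theorem HasLeadingMonomial.mul {ω : Fin n → ℝ} {f g : MvPolynomial (Fin n) K}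
    {μ ν : Fin n →₀ ℕ} (hf : HasLeadingMonomial ω f μ) (hg : HasLeadingMonomial ω g ν) :
    HasLeadingMonomial ω (f * g) (μ + ν) := by
  classical
  have key : ∀ a ∈ f.support, ∀ b ∈ g.support, (a, b) ≠ (μ, ν) →
      weight ω (μ + ν) < weight ω (a + b) := by
    intro a ha b hb hne
    rw [weight_add, weight_add]
    by_cases h : a = μ
    · have hb' : b ≠ ν := fun hbν => hne (by rw [h, hbν])
      exact add_lt_add_of_le_of_lt (hf.le ha) (hg.2 b hb hb')
    · exact add_lt_add_of_lt_of_le (hf.2 a ha h) (hg.le hb)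
  constructor
  · rw [MvPolynomial.coeff_mul, Finset.sum_eq_single (μ, ν)]
    · exact mul_ne_zero hf.1 hg.1
    · rintro ⟨a, b⟩ hab hne
      by_contra h0
      have ha : a ∈ f.support := MvPolynomial.mem_support_iff.mpr (left_ne_zero_of_mul h0)
      have hb : b ∈ g.support := MvPolynomial.mem_support_iff.mpr (right_ne_zero_of_mul h0)
      have := key a ha b hb hne
      rw [Finset.HasAntidiagonal.mem_antidiagonal.mp hab] at this
      exact lt_irrefl _ this
    · simp
  · intro ξ hξ hne
    obtain ⟨a, ha, b, hb, rfl⟩ := Finset.mem_add.mp (MvPolynomial.support_mul f g hξ)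
    refine key a ha b hb fun h => hne ?_
    rw [(Prod.mk.inj h).1, (Prod.mk.inj h).2]

theorem HasLeadingMonomial.pow {ω : Fin n → ℝ} {f : MvPolynomial (Fin n) K} {μ : Fin n →₀ ℕ}
    (hf : HasLeadingMonomial ω f μ) (k : ℕ) : HasLeadingMonomial ω (f ^ k) (k • μ) := by
  induction k with
  | zero => simpa using hasLeadingMonomial_monomial ω (0 : Fin n →₀ ℕ) (one_ne_zero (α := K))
  | succ k ih => rw [pow_succ, succ_nsmul]; exact ih.mul hf

theorem HasLeadingMonomial.initialForm_eq {ω : Fin n → ℝ} {f : MvPolynomial (Fin n) K}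
    {μ : Fin n →₀ ℕ} (hf : HasLeadingMonomial ω f μ) :
    initialForm ω f = MvPolynomial.monomial μ (f.coeff μ) := by
  classical
  have hμ : μ ∈ f.support := MvPolynomial.mem_support_iff.mpr hf.1
  have : (f.support.filter fun a => ∀ b ∈ f.support, weight ω a ≤ weight ω b) = {μ} := by
    ext a
    simp only [Finset.mem_filter, Finset.mem_singleton]
    constructor
    · rintro ⟨ha, hmin⟩
      by_contra hne
      exact (hf.2 a ha hne).not_ge (hmin μ hμ)
    · rintro rfl
      exact ⟨hμ, fun b hb => hf.le hb⟩
  unfold initialForm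
  convert Finset.sum_singleton (fun a => MvPolynomial.monomial a (f.coeff a)) μ

theorem coeff_initialForm (ω : Fin n → ℝ) (f : MvPolynomial (Fin n) K) (ν : Fin n →₀ ℕ)
    (h : (initialForm ω f).coeff ν ≠ 0) :
    (∀ μ ∈ f.support, weight ω ν ≤ weight ω μ) := by
  classical
  unfold initialForm at h
  rw [MvPolynomial.coeff_sum] at h
  obtain ⟨μ, hμ, hne⟩ := Finset.exists_ne_zero_of_sum_ne_zero h
  rw [MvPolynomial.coeff_monomial] at hne
  obtain rfl : μ = ν := by
    by_contra hμν
    simp [hμν] at hne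
  exact (Finset.mem_filter.mp hμ).2

theorem coeff_initialForm_of_le (ω : Fin n → ℝ) (f : MvPolynomial (Fin n) K) (ν : Fin n →₀ ℕ)
    (h : ∀ μ ∈ f.support, weight ω ν ≤ weight ω μ) :
    (initialForm ω f).coeff ν = f.coeff ν := by
  classical
  unfold initialForm
  rw [MvPolynomial.coeff_sum]
  simp only [MvPolynomial.coeff_monomial]
  rw [Finset.sum_ite_eq']
  by_cases hν : ν ∈ f.support
  · rw [if_pos (Finset.mem_filter.mpr ⟨hν, h⟩)]
  · rw [if_neg fun h' => hν (Finset.mem_filter.mp h').1]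
    exact (MvPolynomial.notMem_support_iff.mp hν).symm

/-- Every weighted homogeneous component of an element of the initial ideal is the lowest part of
an element of the ideal. -/
theorem exists_lift_of_mem_initialIdeal {ω : Fin n → ℝ} {I : Ideal (MvPolynomial (Fin n) K)}
    {g : MvPolynomial (Fin n) K} (hg : g ∈ initialIdeal ω I) (t : ℝ) :
    ∃ f ∈ I, ∀ ν, (weight ω ν < t → f.coeff ν = 0) ∧
      (weight ω ν = t → f.coeff ν = g.coeff ν) := by
  classical
  unfold initialIdeal at hg
  induction hg using Submodule.span_induction generalizing t with
  | mem g hg =>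
    obtain ⟨f, hf, rfl⟩ := hg
    -- An initial form is homogeneous for the weight, so its part of weight t is either the whole
    -- form, lifted by f, or zero, lifted by 0.
    by_cases h : ∃ ν, weight ω ν = t ∧ (initialForm ω f).coeff ν ≠ 0
    · obtain ⟨ν, rfl, hν⟩ := h
      have hmin := coeff_initialForm ω f ν hν
      refine ⟨f, hf, fun ξ => ⟨fun hlt => ?_, fun heq => ?_⟩⟩
      · by_contra h0
        exact (hmin ξ (MvPolynomial.mem_support_iff.mpr h0)).not_gt hlt
      · exact (coeff_initialForm_of_le ω f ξ (by rwa [heq])).symm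
    · push Not at h
      exact ⟨0, I.zero_mem, fun ν => ⟨fun _ => by simp, fun heq => by simp [h ν heq]⟩⟩
  | zero => exact ⟨0, I.zero_mem, fun ν => by simp⟩
  | add g g' _ _ ih ih' =>
    obtain ⟨f, hf, h⟩ := ih t
    obtain ⟨f', hf', h'⟩ := ih' t
    refine ⟨f + f', I.add_mem hf hf', fun ν => ⟨fun hlt => ?_, fun heq => ?_⟩⟩
    · simp [(h ν).1 hlt, (h' ν).1 hlt]
    · simp [(h ν).2 heq, (h' ν).2 heq]
  | smul a g _ ih =>
    rw [smul_eq_mul]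
    -- Multiplication by a monomial shifts weights by a constant. This is why the statement is
    -- proved for all t simultaneously.
    induction a using MvPolynomial.induction_on' generalizing t with
    | monomial ξ c =>
      obtain ⟨f, hf, h⟩ := ih (t - weight ω ξ)
      have hw : ∀ ν, ξ ≤ ν → weight ω (ν - ξ) = weight ω ν - weight ω ξ := fun ν hν => by
        rw [eq_sub_iff_add_eq, ← weight_add, tsub_add_cancel_of_le hν]
      refine ⟨MvPolynomial.monomial ξ c * f, I.mul_mem_left _ hf,
        fun ν => ⟨fun hlt => ?_, fun heq => ?_⟩⟩
      · rw [MvPolynomial.coeff_monomial_mul']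
        split_ifs with hν
        · rw [(h _).1 (by rw [hw ν hν]; linarith), mul_zero]
        · rfl
      · rw [MvPolynomial.coeff_monomial_mul', MvPolynomial.coeff_monomial_mul']
        split_ifs with hν
        · rw [(h _).2 (by rw [hw ν hν, heq])]
        · rfl
    | add a b iha ihb =>
      obtain ⟨f, hf, h⟩ := iha t
      obtain ⟨f', hf', h'⟩ := ihb t
      refine ⟨f + f', I.add_mem hf hf', fun ν => ⟨fun hlt => ?_, fun heq => ?_⟩⟩
      · simp [(h ν).1 hlt, (h' ν).1 hlt]
      · simp [add_mul, (h ν).2 heq, (h' ν).2 heq]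

/-- The weights outside the tropical variety are those for which some element of the ideal has a
monomial as its initial form. -/
theorem notMem_tropicalVariety_iff {ω : Fin n → ℝ} {I : Ideal (MvPolynomial (Fin n) K)} :
    ω ∉ tropicalVariety I ↔ ∃ f ∈ I, ∃ μ, HasLeadingMonomial ω f μ := by
  classical
  simp only [tropicalVariety, Set.mem_ofPred_eq, not_forall, not_not]
  constructor
  · rintro ⟨μ, hμ⟩
    obtain ⟨f, hf, h⟩ := exists_lift_of_mem_initialIdeal hμ (weight ω μ)
    refine ⟨f, hf, μ, ?_, fun ν hν hne => ?_⟩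
    · simp [(h μ).2 rfl]
    · rw [MvPolynomial.mem_support_iff] at hν
      by_contra hlt
      rcases (not_lt.mp hlt).lt_or_eq with h1 | h1
      · exact hν ((h ν).1 h1)
      · refine hν ?_
        rw [(h ν).2 h1, MvPolynomial.coeff_monomial, if_neg (Ne.symm hne)]
  · rintro ⟨f, hf, μ, h⟩
    refine ⟨μ, ?_⟩
    have h1 : MvPolynomial.monomial μ (f.coeff μ) ∈ initialIdeal ω I := by
      rw [← h.initialForm_eq]
      exact Ideal.subset_span ⟨f, hf, rfl⟩
    have h2 := (initialIdeal ω I).mul_mem_left (MvPolynomial.C (f.coeff μ)⁻¹) h1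
    rwa [MvPolynomial.C_mul_monomial, inv_mul_cancel₀ h.1] at h2

/-- Having a given leading monomial is a finite system of strict linear inequalities in the weight,
so an element that excludes ω also excludes all nearby weights. -/
theorem isClosed_tropicalVariety (I : Ideal (MvPolynomial (Fin n) K)) :
    IsClosed (tropicalVariety I) := by
  rw [← isOpen_compl_iff, isOpen_iff_mem_nhds]
  intro ω hω
  obtain ⟨f, hf, μ, h⟩ := notMem_tropicalVariety_iff.mp hω
  have hopen : IsOpen (⋂ ν ∈ f.support.filter (· ≠ μ), {u | weight u μ < weight u ν}) :=
    isOpen_biInter_finset fun ν _ => isOpen_lt (continuous_weight μ) (continuous_weight ν)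
  refine Filter.mem_of_superset (hopen.mem_nhds ?_) ?_
  · simp only [Set.mem_iInter, Finset.mem_filter]
    exact fun ν hν => h.2 ν hν.1 hν.2
  · intro u hu
    simp only [Set.mem_iInter, Finset.mem_filter] at hu
    exact notMem_tropicalVariety_iff.mpr ⟨f, hf, μ, h.1, fun ν hν hne => hu ν ⟨hν, hne⟩⟩

theorem groebnerCone_subset_tropicalVariety {ω : Fin n → ℝ}
    {I : Ideal (MvPolynomial (Fin n) K)} (hω : ω ∈ tropicalVariety I) :
    groebnerCone I ω ⊆ tropicalVariety I := by
  refine closure_minimal (fun u hu μ => ?_) (isClosed_tropicalVariety I)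
  rw [Set.mem_ofPred_eq] at hu
  rw [hu]
  exact hω μ

end Leading

/-! ### Primes that are maximal among those avoiding an element -/

section PrimeAvoidance

/-- Krull's principal ideal theorem bounds the height of Q by one, and in a domain only the zero
ideal is a prime of height zero. -/
theorem eq_bot_of_lt_of_mem_minimalPrimes_span_singleton {R : Type*} [CommRing R] [IsDomain R]
    [IsNoetherianRing R] {a : R} {P Q : Ideal R} [P.IsPrime]
    (hQ : Q ∈ (Ideal.span {a}).minimalPrimes) (hlt : P < Q) : P = ⊥ := by
  have h1 : Q.height ≤ ((1 : ℕ) : ℕ∞) :=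
    Ideal.height_le_one_of_isPrincipal_of_mem_minimalPrimes (Ideal.span {a}) Q hQ
  have := hQ.1.1
  have h2 := Ideal.height_le_iff.mp h1 P inferInstance hlt
  have h3 : P.height = 0 := by simpa [Order.lt_one_iff] using h2
  rw [Ideal.height_eq_zero_iff, IsDomain.minimalPrimes_eq_singleton_bot] at h3
  exact h3

/-- In a Noetherian domain, if all nonzero primes contained in the prime `m` contain `h ∈ m`,
then no nonzero prime is strictly contained in `m`. -/
theorem eq_of_forall_prime_mem {R : Type*} [CommRing R] [IsDomain R] [IsNoetherianRing R]
    {m : Ideal R} [m.IsPrime] {h : R} (hm : h ∈ m) (h0 : h ≠ 0)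
    (hh : ∀ P : Ideal R, P.IsPrime → P ≤ m → P ≠ ⊥ → h ∈ P)
    {P : Ideal R} [P.IsPrime] (hP : P ≤ m) (hne : P ≠ ⊥) : P = m := by
  by_contra hPm
  have hlt : P < m := lt_of_le_of_ne hP hPm
  have hfin := Ideal.finite_minimalPrimes_of_isNoetherianRing R (Ideal.span {h})
  -- Prime avoidance: if m were covered by the finitely many minimal primes of (h), it would lie in
  -- one of them, leaving no room for the nonzero prime P strictly below.
  have hav : ¬ (m : Set R) ⊆ ⋃ Q ∈ (hfin.toFinset : Set (Ideal R)), (Q : Set R) := by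
    intro hsub
    obtain ⟨Q, hQ, hle⟩ := (Ideal.subset_union_prime (f := fun Q : Ideal R => Q) ⊥ ⊥
      (fun Q hQ _ _ => ((hfin.mem_toFinset).mp hQ).1.1)).mp hsub
    exact hne (eq_bot_of_lt_of_mem_minimalPrimes_span_singleton ((hfin.mem_toFinset).mp hQ)
      (hlt.trans_le hle))
  obtain ⟨a, ham, ha⟩ := Set.not_subset.mp hav
  simp only [Set.Finite.coe_toFinset, Set.mem_iUnion, not_exists] at ha
  obtain ⟨Q, hQ, -⟩ := Ideal.exists_minimalPrimes_le
    ((Ideal.span_singleton_le_iff_mem _).mpr hm)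
  have ha0 : a ≠ 0 := fun h0 => ha Q hQ (by rw [h0]; exact Q.zero_mem)
  -- P' is minimal over an element a of m outside all minimal primes of (h). It contains h, hence
  -- some minimal prime Q' of (h). As a is in P' but not in Q', the inclusion is strict, so Q' = 0,
  -- which contradicts h ≠ 0.
  obtain ⟨P', hP', hle'⟩ := Ideal.exists_minimalPrimes_le
    ((Ideal.span_singleton_le_iff_mem _).mpr ham)
  have := hP'.1.1
  have haP' : a ∈ P' := hP'.1.2 (Ideal.mem_span_singleton_self a)
  have hP'0 : P' ≠ ⊥ := fun h0 => ha0 (by rwa [h0, Ideal.mem_bot] at haP')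
  obtain ⟨Q', hQ', hQle⟩ := Ideal.exists_minimalPrimes_le
    ((Ideal.span_singleton_le_iff_mem _).mpr (hh P' hP'.1.1 hle' hP'0))
  have := hQ'.1.1
  by_cases hQeq : Q' = P'
  · exact ha Q' hQ' (by rw [hQeq]; exact haP')
  · have hbot := eq_bot_of_lt_of_mem_minimalPrimes_span_singleton hP'
      (lt_of_le_of_ne hQle hQeq)
    have := hQ'.1.2 (Ideal.mem_span_singleton_self h)
    rw [hbot, Ideal.mem_bot] at this
    exact h0 this

theorem disjoint_primeCompl_sup_powers {A : Type*} [CommRing A] {J m : Ideal A} [m.IsPrime]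
    {h : A} (hJ : ∀ g ∉ m, ∀ N : ℕ, g * h ^ N ∉ J) :
    Disjoint (J : Set A) (m.primeCompl ⊔ Submonoid.powers h : Submonoid A) := by
  rw [Set.disjoint_left]
  intro x hx hxS
  obtain ⟨g, hg, _, ⟨N, rfl⟩, rfl⟩ := Submonoid.mem_sup.mp hxS
  exact hJ g hg N hx

/-- If `h` is not nilpotent modulo `J` near `m`, then there is a prime between `J` and `m` that
does not contain `h` and modulo which, near `m`, every element of `m` has a power divisible by
`h`. -/
theorem exists_prime_forall_pow_mem {A : Type*} [CommRing A] [IsNoetherianRing A]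
    {J m : Ideal A} [m.IsPrime] {h : A} (hJ : ∀ g ∉ m, ∀ N : ℕ, g * h ^ N ∉ J) :
    ∃ Q : Ideal A, Q.IsPrime ∧ J ≤ Q ∧ Q ≤ m ∧ h ∉ Q ∧
      ∀ y ∈ m, ∃ g ∉ m, ∃ N : ℕ, g * y ^ N ∈ Ideal.span {h} ⊔ Q := by
  have hdis : ∀ {Q : Ideal A} {a : A},
      Disjoint (Q : Set A) (m.primeCompl ⊔ Submonoid.powers a : Submonoid A) →
        Q ≤ m ∧ a ∉ Q := fun {Q a} hd => by
    refine ⟨fun x hx => ?_, fun ha => ?_⟩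
    · by_contra hxm
      exact Set.disjoint_left.mp hd hx
        ((le_sup_left : _ ≤ m.primeCompl ⊔ Submonoid.powers a) hxm)
    · exact Set.disjoint_left.mp hd ha
        ((le_sup_right : _ ≤ m.primeCompl ⊔ Submonoid.powers a) (Submonoid.mem_powers a))
  obtain ⟨Q₀, hQ₀, hJQ₀, hd₀⟩ :=
    Ideal.exists_le_prime_disjoint J _ (disjoint_primeCompl_sup_powers hJ)
  -- By maximality of Q, every nonzero prime of A/Q inside m/Q contains the class of h, which is the
  -- hypothesis of `eq_of_forall_prime_mem`.
  obtain ⟨Q, ⟨hQ, hJQ, hQm, hhQ⟩, hmax⟩ := set_has_maximal_iff_noetherian.mpr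
    (inferInstance : IsNoetherian A A)
    {Q : Ideal A | Q.IsPrime ∧ J ≤ Q ∧ Q ≤ m ∧ h ∉ Q} ⟨Q₀, hQ₀, hJQ₀, hdis hd₀⟩
  refine ⟨Q, hQ, hJQ, hQm, hhQ, fun y hy => ?_⟩
  by_cases hm : h ∈ m
  swap
  · exact ⟨h, hm, 0, by
      simpa using (le_sup_left : _ ≤ Ideal.span {h} ⊔ Q) (Ideal.mem_span_singleton_self h)⟩
  by_contra hcon
  push Not at hcon
  -- If the claim fails for y, some prime Q' inside m contains (h) + Q but not y. Its image in A/Q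
  -- is nonzero and hence equals m/Q, although y is in m.
  obtain ⟨Q', hQ', hle, hd'⟩ :=
    Ideal.exists_le_prime_disjoint _ _ (disjoint_primeCompl_sup_powers hcon)
  obtain ⟨hQ'm, hyQ'⟩ := hdis hd'
  have hQQ' : Q ≤ Q' := le_sup_right.trans hle
  have hhQ' : h ∈ Q' := hle ((le_sup_left : _ ≤ Ideal.span {h} ⊔ Q)
    (Ideal.mem_span_singleton_self h))
  let π := Ideal.Quotient.mk Q
  have hπ : Function.Surjective π := Ideal.Quotient.mk_surjective
  have hker : RingHom.ker π = Q := Ideal.mk_ker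
  have hmp : (m.map π).IsPrime := Ideal.map_isPrime_of_surjective hπ (by rwa [hker])
  have hQp : (Q'.map π).IsPrime := Ideal.map_isPrime_of_surjective hπ (by rwa [hker])
  have hcm : ∀ P : Ideal A, Q ≤ P → (P.map π).comap π = P := fun P hP => by
    rw [Ideal.comap_map_of_surjective' π hπ, hker, sup_eq_left.mpr hP]
  have hh0 : π h ≠ 0 := fun h0 => hhQ (Ideal.Quotient.eq_zero_iff_mem.mp h0)
  have heq : Q'.map π = m.map π := by
    refine eq_of_forall_prime_mem (h := π h) (Ideal.mem_map_of_mem π hm) hh0 ?_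
      (Ideal.map_mono hQ'm) fun h0 => hh0 ?_
    · intro P hP hPm hP0
      by_contra hhP
      have hQP : Q ≤ P.comap π := hker.symm.le.trans (Ideal.comap_mono bot_le)
      have hPm' : P.comap π ≤ m := by
        rw [← hcm m hQm]
        exact Ideal.comap_mono hPm
      refine hmax (P.comap π) ⟨Ideal.IsPrime.comap π, hJQ.trans hQP, hPm', hhP⟩
        (lt_of_le_of_ne hQP fun heq => hP0 ?_)
      rw [← Ideal.map_comap_of_surjective π hπ P, ← heq]
      exact Ideal.map_quotient_self Q
    · rw [← Ideal.mem_bot, ← h0]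
      exact Ideal.mem_map_of_mem π hhQ'
  apply hyQ'
  rw [← hcm Q' hQQ', heq, hcm m hQm]
  exact hy

end PrimeAvoidance

/-! ### Real weights approximating a valuation -/

section RealWeight

variable {Γ : Type*} [LinearOrderedCommGroupWithZero Γ] {n : ℕ}

theorem prod_zpow_add {γ : Fin n → Γ} (h0 : ∀ i, γ i ≠ 0) (c d : Fin n → ℤ) :
    ∏ i, γ i ^ (c i + d i) = (∏ i, γ i ^ c i) * ∏ i, γ i ^ d i := by
  rw [← Finset.prod_mul_distrib]
  exact Finset.prod_congr rfl fun i _ => zpow_add₀ (h0 i) _ _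

theorem prod_zpow_mul_natCast (γ : Fin n → Γ) (c : Fin n → ℤ) (q : ℕ) :
    ∏ i, γ i ^ (c i * (q : ℤ)) = (∏ i, γ i ^ c i) ^ q := by
  rw [← Finset.prod_pow]
  exact Finset.prod_congr rfl fun i _ => by rw [zpow_mul, zpow_natCast]

/-- The rational multiples of the integer exponents at which the monomial in `γ` is at most
one. -/
def exponentMonoid {γ : Fin n → Γ} (h0 : ∀ i, γ i ≠ 0) : AddSubmonoid (Fin n → ℝ) where
  carrier := {x | ∃ (c : Fin n → ℤ) (q : ℕ), 0 < q ∧ (∀ i, (q : ℝ) * x i = c i) ∧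
    ∏ i, γ i ^ c i ≤ 1}
  zero_mem' := ⟨0, 1, one_pos, by simp, by simp⟩
  add_mem' := by
    rintro x y ⟨c, q, hq, hx, hc⟩ ⟨d, r, hr, hy, hd⟩
    refine ⟨fun i => c i * (r : ℤ) + d i * (q : ℤ), q * r, Nat.mul_pos hq hr, fun i => ?_, ?_⟩
    · push_cast
      rw [← hx i, ← hy i, Pi.add_apply]
      ring
    · rw [prod_zpow_add h0, prod_zpow_mul_natCast, prod_zpow_mul_natCast]
      exact mul_le_one' (pow_le_one' hc r) (pow_le_one' hd q)

theorem intCast_mem_exponentMonoid {γ : Fin n → Γ} (h0 : ∀ i, γ i ≠ 0) {c : Fin n → ℤ}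
    (hc : ∏ i, γ i ^ c i ≤ 1) : (fun i => (c i : ℝ)) ∈ exponentMonoid h0 :=
  ⟨c, 1, one_pos, by simp, hc⟩

theorem ratCast_smul_mem_exponentMonoid {γ : Fin n → Γ} (h0 : ∀ i, γ i ≠ 0) {r : ℚ} (hr : 0 ≤ r)
    {x : Fin n → ℝ} (hx : x ∈ exponentMonoid h0) : (r : ℝ) • x ∈ exponentMonoid h0 := by
  obtain ⟨c, q, hq, hx, hc⟩ := hx
  refine ⟨fun i => c i * (r.num.toNat : ℤ), q * r.den, Nat.mul_pos hq r.den_pos, fun i => ?_, ?_⟩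
  · have h1 : (r : ℝ) * r.den = r.num := by exact_mod_cast Rat.mul_den_eq_num r
    have h2 : ((r.num.toNat : ℤ) : ℝ) = r.num := by
      rw [Int.toNat_of_nonneg (Rat.num_nonneg.mpr hr)]
    rw [Int.cast_mul, h2, ← h1, ← hx i, Pi.smul_apply, smul_eq_mul]
    push_cast
    ring
  · rw [prod_zpow_mul_natCast]
    exact pow_le_one' hc _

/-- The monoid is stable under nonnegative rational scaling, so its closure is stable under
nonnegative real scaling and is a convex cone. -/
theorem convex_closure_exponentMonoid {γ : Fin n → Γ} (h0 : ∀ i, γ i ≠ 0) :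
    Convex ℝ ((exponentMonoid h0).topologicalClosure : Set (Fin n → ℝ)) := by
  have hsmul : ∀ r : ℝ, 0 ≤ r → ∀ x ∈ (exponentMonoid h0).topologicalClosure,
      r • x ∈ (exponentMonoid h0).topologicalClosure := by
    intro r hr x hx
    have hx' : ∀ q : ℚ, 0 ≤ q → (q : ℝ) • x ∈ (exponentMonoid h0).topologicalClosure := by
      intro q hq
      exact map_mem_closure (continuous_const_smul (q : ℝ)) hx
        fun y hy => ratCast_smul_mem_exponentMonoid h0 hq hy
    -- Approximation from above keeps the rational factors nonnegative, also for r = 0.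
    obtain ⟨u, -, hu, hlim⟩ := Real.exists_seq_rat_strictAnti_tendsto r
    have hcl := (exponentMonoid h0).isClosed_topologicalClosure
    refine hcl.mem_of_tendsto (hlim.smul_const x) (Filter.Eventually.of_forall fun k => ?_)
    exact hx' (u k) (by exact_mod_cast hr.trans (hu k).le)
  intro x hx y hy a b ha hb _
  exact add_mem (hsmul a ha x hx) (hsmul b hb y hy)

/-- Negative powers of elements at most 1 are at least 1, and the factor at `i₀` makes the product
exceed 1. The negative orthant is open, so it also misses the closure. -/
theorem disjoint_neg_closure_exponentMonoid {γ : Fin n → Γ} (h0 : ∀ i, γ i ≠ 0)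
    (hle : ∀ i, γ i ≤ 1) {i₀ : Fin n} (hi₀ : γ i₀ < 1) :
    Disjoint (Set.univ.pi fun _ : Fin n => Set.Iio (0 : ℝ))
      ((exponentMonoid h0).topologicalClosure : Set (Fin n → ℝ)) := by
  rw [AddSubmonoid.coe_topologicalClosure]
  refine Disjoint.closure_right ?_ (isOpen_set_pi Set.finite_univ fun _ _ => isOpen_Iio)
  rw [Set.disjoint_left]
  rintro x hx ⟨c, q, hq, hc, hle1⟩
  have hneg : ∀ i, c i < 0 := fun i => by
    have h1 : x i < 0 := hx i (Set.mem_univ i)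
    have h2 : (c i : ℝ) < 0 := by
      rw [← hc i]
      exact mul_neg_of_pos_of_neg (by exact_mod_cast hq) h1
    exact_mod_cast h2
  have hpos : ∀ i, 0 < γ i := fun i => zero_lt_iff.mpr (h0 i)
  refine hle1.not_gt ?_
  have hge : ∀ i, 1 ≤ γ i ^ c i := fun i => by
    obtain ⟨k, hk⟩ := Int.eq_ofNat_of_zero_le (neg_nonneg.mpr (hneg i).le)
    rw [← neg_neg (c i), hk, zpow_neg, zpow_natCast]
    exact (one_le_inv₀ (pow_pos (hpos i) k)).mpr (pow_le_one' (hle i) k)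
  have hgt : 1 < γ i₀ ^ c i₀ := by
    obtain ⟨k, hk⟩ := Int.eq_ofNat_of_zero_le (neg_nonneg.mpr (hneg i₀).le)
    have hk0 : k ≠ 0 := fun h => by
      have := hneg i₀
      omega
    rw [← neg_neg (c i₀), hk, zpow_neg, zpow_natCast]
    exact (one_lt_inv₀ (pow_pos (hpos i₀) k)).mpr (pow_lt_one' hi₀ hk0)
  rw [← Finset.mul_prod_erase _ _ (Finset.mem_univ i₀)]
  exact one_lt_mul_of_lt_of_le' hgt (Finset.one_le_prod' fun i _ => hge i)

/-- Elements of a totally ordered group with pairwise comparable powers admit real weights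
compatible with the order of their monomials. -/
theorem exists_real_weight {γ : Fin n → Γ} (h0 : ∀ i, γ i ≠ 0) (hle : ∀ i, γ i ≤ 1)
    (hpow : ∀ i, γ i < 1 → ∃ N : ℕ, γ i ^ N ≤ ∏ j, γ j) :
    ∃ w : Fin n → ℝ, (∀ i, γ i < 1 → 0 < w i) ∧ (∀ i, γ i = 1 → w i = 0) ∧
      ∀ a b : Fin n → ℕ, ∑ i, w i * a i < ∑ i, w i * b i →
        ∏ i, γ i ^ b i < ∏ i, γ i ^ a i := by
  by_cases hex : ∃ i₀, γ i₀ < 1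
  swap
  · push Not at hex
    exact ⟨0, fun i hi => absurd hi (hex i).not_gt, fun _ _ => rfl, fun a b h => by simp at h⟩
  obtain ⟨i₀, hi₀⟩ := hex
  -- The separating functional will be nonnegative on the monoid and negative on the open negative
  -- orthant; its values on the standard basis are the weights.
  obtain ⟨f, u, hfO, hfD⟩ := geometric_hahn_banach_open
    (convex_pi fun _ _ => convex_Iio (0 : ℝ))
    (isOpen_set_pi Set.finite_univ fun _ _ => isOpen_Iio)
    (convex_closure_exponentMonoid h0) (disjoint_neg_closure_exponentMonoid h0 hle hi₀)
  have hsub : ∀ x ∈ exponentMonoid h0, u ≤ f x := fun x hx =>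
    hfD x ((exponentMonoid h0).le_topologicalClosure hx)
  have hu0 : u ≤ 0 := by simpa using hsub 0 (zero_mem _)
  have hnn : ∀ x ∈ exponentMonoid h0, 0 ≤ f x := by
    intro x hx
    by_contra hlt
    push Not at hlt
    -- A functional bounded below on a monoid is nonnegative there: multiples of a negative value
    -- would go below `u`.
    obtain ⟨k, hk⟩ := Archimedean.arch (-u + 1) (neg_pos.mpr hlt)
    have h1 := hsub (k • x) (nsmul_mem hx k)
    rw [map_nsmul] at h1
    rw [smul_neg] at hk
    linarith
  let w : Fin n → ℝ := fun i => f (Pi.single i 1)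
  have hf : ∀ x : Fin n → ℝ, f x = ∑ i, w i * x i := by
    intro x
    conv_lhs => rw [pi_eq_sum_univ' x, map_sum]
    refine Finset.sum_congr rfl fun i _ => ?_
    rw [map_smul, smul_eq_mul, mul_comm]
  have hint : ∀ c : Fin n → ℤ, ∏ i, γ i ^ c i ≤ 1 → 0 ≤ ∑ i, w i * (c i : ℝ) := fun c hc => by
    rw [← hf fun i => (c i : ℝ)]
    exact hnn _ (intCast_mem_exponentMonoid h0 hc)
  have hsingle : ∀ (i : Fin n) (k : ℤ), ∏ j, γ j ^ (Pi.single i k : Fin n → ℤ) j = γ i ^ k := by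
    intro i k
    rw [Finset.prod_eq_single i]
    · simp
    · intro j _ hj
      simp [hj]
    · simp
  have hsum : ∀ (i : Fin n) (k : ℤ),
      ∑ j, w j * (((Pi.single i k : Fin n → ℤ) j : ℤ) : ℝ) = w i * k := by
    intro i k
    rw [Finset.sum_eq_single i]
    · simp
    · intro j _ hj
      simp [hj]
    · simp
  have hw0 : ∀ i, 0 ≤ w i := fun i => by
    have := hint (Pi.single i 1) (by rw [hsingle, zpow_one]; exact hle i)
    rw [hsum] at this
    simpa using this
  have hwpos : 0 < ∑ i, w i := by
    have := (hfO (fun _ => -1) fun _ _ => by simp).trans_le hu0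
    rw [hf] at this
    simpa using this
  refine ⟨w, fun i hi => ?_, fun i hi => ?_, fun a b hab => ?_⟩
  · obtain ⟨N, hN⟩ := hpow i hi
    -- The exponent N e_i − (1, …, 1) is in the monoid by the power hypothesis, so N w_i is at least
    -- the sum of all weights, which is positive.
    have := hint (fun j => (Pi.single i (N : ℤ) : Fin n → ℤ) j + (-1 : ℤ)) (by
      rw [prod_zpow_add h0 (Pi.single i (N : ℤ)) fun _ => (-1 : ℤ), hsingle, zpow_natCast]
      simp only [zpow_neg_one, Finset.prod_inv_distrib, ← div_eq_mul_inv]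
      exact (div_le_one₀ (zero_lt_iff.mpr (Finset.prod_ne_zero_iff.mpr fun j _ => h0 j))).mpr hN)
    simp only [Int.cast_add, mul_add, Finset.sum_add_distrib, hsum] at this
    have h2 : 0 < w i * N := by
      simp at this
      linarith
    exact pos_of_mul_pos_left h2 (by positivity)
  · have := hint (Pi.single i (-1)) (by rw [hsingle, hi, one_zpow])
    rw [hsum] at this
    have h2 := hw0 i
    simp at this
    linarith
  · by_contra hcon
    push Not at hcon
    have := hint (fun i => (a i : ℤ) + -(b i : ℤ)) (by
      rw [prod_zpow_add h0 (fun i => (a i : ℤ)) fun i => -(b i : ℤ)]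
      simp only [zpow_neg, Finset.prod_inv_distrib, zpow_natCast, ← div_eq_mul_inv]
      exact (div_le_one₀ (zero_lt_iff.mpr
        (Finset.prod_ne_zero_iff.mpr fun j _ => pow_ne_zero _ (h0 j)))).mpr hcon)
    simp only [Int.cast_add, Int.cast_neg, Int.cast_natCast, mul_add, mul_neg,
      Finset.sum_add_distrib, Finset.sum_neg_distrib] at this
    linarith

end RealWeight

/-! ### Monomial substitutions in polynomials -/

section Substitution

variable {K : Type*} [Field K] {n : ℕ}

/-- The exponent of `x ^ b` times the monomial with exponent `a` in the coordinates of `φ_N`; it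
is meaningful where this exponent is nonnegative. -/
def shiftedExponent (N : Matrix (Fin n) (Fin n) ℤ) (b : Fin n → ℕ) (a : Fin n →₀ ℕ) :
    Fin n →₀ ℕ :=
  Finsupp.equivFunOnFinite.symm fun j => ((b j : ℤ) + ∑ i, N j i * (a i : ℤ)).toNat

/-- The product of `x ^ b` and `g ∘ φ_N`, if it is a polynomial. -/
def substitution (N : Matrix (Fin n) (Fin n) ℤ) (b : Fin n → ℕ) (g : MvPolynomial (Fin n) K) :
    MvPolynomial (Fin n) K :=
  ∑ a ∈ g.support, MvPolynomial.monomial (shiftedExponent N b a) (g.coeff a)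

/-- `x ^ b` clears the denominators of `g ∘ φ_N`. -/
def ClearsDenominators (N : Matrix (Fin n) (Fin n) ℤ) (b : Fin n → ℕ)
    (g : MvPolynomial (Fin n) K) : Prop :=
  ∀ a ∈ g.support, ∀ j, 0 ≤ (b j : ℤ) + ∑ i, N j i * (a i : ℤ)

/-- The factor x^b involves only coordinates that occur in denominators of φ_N. It therefore does
not vanish where φ_N is regular, including points outside the torus, and can be cancelled there. -/
theorem exists_clearsDenominators (N : Matrix (Fin n) (Fin n) ℤ) (g : MvPolynomial (Fin n) K) :
    ∃ b : Fin n → ℕ, (∀ j, b j ≠ 0 → ∃ i, N j i < 0) ∧ ClearsDenominators N b g := by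
  classical
  refine ⟨fun j => if ∃ i, N j i < 0 then
    ∑ a ∈ g.support, (∑ i, N j i * (a i : ℤ)).natAbs else 0, fun j hj => ?_, fun a ha j => ?_⟩
  · by_contra h
    exact hj (if_neg h)
  · dsimp only
    split_ifs with h
    · have h1 : (∑ i, N j i * (a i : ℤ)).natAbs ≤
          ∑ a ∈ g.support, (∑ i, N j i * (a i : ℤ)).natAbs :=
        Finset.single_le_sum (f := fun a : Fin n →₀ ℕ => (∑ i, N j i * (a i : ℤ)).natAbs)
          (fun _ _ => Nat.zero_le _) ha
      omega
    · push Not at h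
      simpa using Finset.sum_nonneg fun i _ => mul_nonneg (h i) (Int.natCast_nonneg (a i))

theorem clearsDenominators_zero {N : Matrix (Fin n) (Fin n) ℤ} (hN : ∀ i j, 0 ≤ N i j)
    (g : MvPolynomial (Fin n) K) : ClearsDenominators N 0 g := fun a _ j => by
  simpa using Finset.sum_nonneg fun i _ => mul_nonneg (hN j i) (Int.natCast_nonneg (a i))

theorem pow_toNat_eq_mul_prod (x : K) (c : Fin n → ℤ) (b : ℕ) (a : Fin n →₀ ℕ)
    (hx : x = 0 → b = 0 ∧ ∀ i, 0 ≤ c i) (h : 0 ≤ (b : ℤ) + ∑ i, c i * (a i : ℤ)) :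
    x ^ ((b : ℤ) + ∑ i, c i * (a i : ℤ)).toNat = x ^ b * ∏ i, (x ^ c i) ^ a i := by
  rw [← zpow_natCast x (Int.toNat _), Int.toNat_of_nonneg h]
  by_cases hx0 : x = 0
  · obtain ⟨rfl, hc⟩ := hx hx0
    obtain ⟨d, rfl⟩ : ∃ d : Fin n → ℕ, c = fun i => (d i : ℤ) :=
      ⟨fun i => (c i).toNat, funext fun i => (Int.toNat_of_nonneg (hc i)).symm⟩
    simp only [Nat.cast_zero, zero_add, pow_zero, one_mul, zpow_natCast, ← pow_mul]
    rw [Finset.prod_pow_eq_pow_sum]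
    exact_mod_cast zpow_natCast x _
  · rw [zpow_add₀ hx0, zpow_natCast]
    congr 1
    induction (Finset.univ : Finset (Fin n)) using Finset.induction_on with
    | empty => simp
    | insert i s hi ih =>
      rw [Finset.sum_insert hi, Finset.prod_insert hi, zpow_add₀ hx0, ih, zpow_mul, zpow_natCast]

theorem eval_substitution {N : Matrix (Fin n) (Fin n) ℤ} {b : Fin n → ℕ}
    {g : MvPolynomial (Fin n) K} (hb : ∀ j, b j ≠ 0 → ∃ i, N j i < 0)
    (hg : ClearsDenominators N b g) {x : Fin n → K} (hx : RegularAt N x) :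
    MvPolynomial.eval x (substitution N b g) =
      (∏ j, x j ^ b j) * MvPolynomial.eval (monomialMap N x) g := by
  rw [substitution, map_sum, MvPolynomial.eval_eq', Finset.mul_sum]
  refine Finset.sum_congr rfl fun a ha => ?_
  rw [MvPolynomial.eval_monomial, Finsupp.prod_fintype _ _ fun i => pow_zero _,
    mul_left_comm]
  congr 1
  simp only [monomialMap, ← Finset.prod_pow]
  rw [Finset.prod_comm, ← Finset.prod_mul_distrib]
  refine Finset.prod_congr rfl fun j _ => ?_
  refine pow_toNat_eq_mul_prod (x j) (N j) (b j) a (fun hxj => ?_) (hg a ha j)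
  have hN : ∀ i, 0 ≤ N j i := fun i => not_lt.mp fun hlt => hx i j hlt hxj
  refine ⟨?_, hN⟩
  by_contra hbj
  obtain ⟨i, hi⟩ := hb j hbj
  exact absurd (hN i) (not_le.mpr hi)

theorem prod_pow_ne_zero {N : Matrix (Fin n) (Fin n) ℤ} {b : Fin n → ℕ}
    (hb : ∀ j, b j ≠ 0 → ∃ i, N j i < 0) {x : Fin n → K} (hx : RegularAt N x) :
    ∏ j, x j ^ b j ≠ 0 := by
  refine Finset.prod_ne_zero_iff.mpr fun j _ => ?_
  by_cases hbj : b j = 0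
  · simp [hbj]
  · obtain ⟨i, hi⟩ := hb j hbj
    exact pow_ne_zero _ (hx i j hi)

/-- Substitution acts on weights by the linear map dual to the one on exponents, up to a constant
independent of `a`. The order of the terms by weight is thus preserved. -/
theorem weight_shiftedExponent {N : Matrix (Fin n) (Fin n) ℤ} {b : Fin n → ℕ} {a : Fin n →₀ ℕ}
    (h : ∀ j, 0 ≤ (b j : ℤ) + ∑ i, N j i * (a i : ℤ)) {w w' : Fin n → ℝ}
    (hw : ∀ i, w' i = ∑ j, w j * (N j i : ℝ)) :
    weight w (shiftedExponent N b a) = ∑ j, w j * (b j : ℝ) + weight w' a := by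
  have h1 : ∀ j, ((shiftedExponent N b a j : ℕ) : ℝ) =
      (b j : ℝ) + ∑ i, (N j i : ℝ) * (a i : ℝ) := fun j => by
    have : ((shiftedExponent N b a j : ℕ) : ℤ) = (b j : ℤ) + ∑ i, N j i * (a i : ℤ) :=
      Int.toNat_of_nonneg (h j)
    exact_mod_cast congrArg (fun z : ℤ => (z : ℝ)) this
  simp only [weight, h1, hw, mul_add, Finset.sum_add_distrib, Finset.mul_sum, Finset.sum_mul]
  congr 1
  rw [Finset.sum_comm]
  refine Finset.sum_congr rfl fun i _ => Finset.sum_congr rfl fun j _ => ?_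
  ring

theorem HasLeadingMonomial.substitution {N : Matrix (Fin n) (Fin n) ℤ} {b : Fin n → ℕ}
    {g : MvPolynomial (Fin n) K} {w w' : Fin n → ℝ} {α : Fin n →₀ ℕ}
    (hg : ClearsDenominators N b g) (hw : ∀ i, w' i = ∑ j, w j * (N j i : ℝ))
    (h : HasLeadingMonomial w' g α) :
    HasLeadingMonomial w (substitution N b g) (shiftedExponent N b α) := by
  classical
  have hα : α ∈ g.support := MvPolynomial.mem_support_iff.mpr h.1
  have hlt : ∀ a ∈ g.support, a ≠ α →
      weight w (shiftedExponent N b α) < weight w (shiftedExponent N b a) := by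
    intro a ha hne
    rw [weight_shiftedExponent (hg a ha) hw, weight_shiftedExponent (hg α hα) hw]
    exact add_lt_add_right (h.2 a ha hne) _
  constructor
  · rw [ToricTropical.substitution, MvPolynomial.coeff_sum, Finset.sum_eq_single α]
    · simpa using h.1
    · intro a ha hne
      rw [MvPolynomial.coeff_monomial, if_neg]
      intro heq
      exact (hlt a ha hne).ne (by rw [heq])
    · exact fun hnot => absurd hα hnot
  · intro ν hν hne
    obtain ⟨a, ha, hνa⟩ := Finset.mem_biUnion.mp (MvPolynomial.support_sum hν)
    obtain rfl : ν = shiftedExponent N b a := by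
      simpa using MvPolynomial.support_monomial_subset hνa
    exact hlt a ha fun haα => hne (by rw [haα])

end Substitution

/-! ### The strict transform in the charts -/

section Charts

variable {K : Type*} [Field K] {n : ℕ} {F : RegularFan n}

theorem monomialMap_ne_zero {x : Fin n → K} (hx : ∀ i, x i ≠ 0)
    (N : Matrix (Fin n) (Fin n) ℤ) (i : Fin n) : monomialMap N x i ≠ 0 :=
  Finset.prod_ne_zero_iff.mpr fun j _ => zpow_ne_zero _ (hx j)

theorem regularAt_of_ne_zero {x : Fin n → K} (hx : ∀ i, x i ≠ 0)
    (N : Matrix (Fin n) (Fin n) ℤ) : RegularAt N x := fun _ j _ => hx j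

theorem ne_zero_of_monomialMap_ne_zero (M : MaxCone F) {x : Fin n → K}
    (hx : ∀ i, monomialMap M.1.valᵀ x i ≠ 0) (j : Fin n) : x j ≠ 0 := by
  intro h0
  have hcol : ∃ i, M.1.val i j ≠ 0 := by
    by_contra hall
    push Not at hall
    have h1 : (M.1⁻¹.val * M.1.val) j j = 1 := by rw [Units.inv_mul, Matrix.one_apply_eq]
    rw [Matrix.mul_apply, Finset.sum_eq_zero fun i _ => by rw [hall i, mul_zero]] at h1
    exact zero_ne_one h1
  obtain ⟨i, hi⟩ := hcol
  refine hx i (Finset.prod_eq_zero (Finset.mem_univ j) ?_)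
  rw [h0, Matrix.transpose_apply, zero_zpow _ hi]

/-- The trace on the chart of `Cone(M)` of the preimage of the part of `V` in the torus. -/
def torusTrace (V : Set (Fin n → K)) (M : MaxCone F) : Set (Fin n → K) :=
  {x | monomialMap M.1.valᵀ x ∈ V ∧ ∀ i, monomialMap M.1.valᵀ x i ≠ 0}

theorem torusTrace_ne_zero {V : Set (Fin n → K)} {M : MaxCone F} {x : Fin n → K}
    (hx : x ∈ torusTrace V M) (i : Fin n) : x i ≠ 0 :=
  ne_zero_of_monomialMap_ne_zero M hx.2 i

theorem monomialMap_transition_mem_torusTrace {V : Set (Fin n → K)} {M M' : MaxCone F}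
    {x : Fin n → K} (hx : x ∈ torusTrace V M) :
    monomialMap (transition M.1 M'.1) x ∈ torusTrace V M' := by
  have hx0 := torusTrace_ne_zero hx
  have heq : monomialMap M'.1.valᵀ (monomialMap (transition M.1 M'.1) x) =
      monomialMap M.1.valᵀ x := by
    rw [monomialMap_mul (regularAt_of_ne_zero hx0 _)
      (regularAt_of_ne_zero (monomialMap_ne_zero hx0 _) _), transition_mul_transpose]
  exact ⟨by rw [heq]; exact hx.1, by rw [heq]; exact hx.2⟩

/-- An equation of the closure in one chart becomes, after clearing denominators, an equation in the
other. The clearing factor is nonzero at the glued point, so the chartwise closures agree on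
overlaps. -/
theorem glue_mem_zeroLocus {V : Set (Fin n → K)} {p q : ChartPoint K F} (h : Glue p q)
    (hp : p.2 ∈ MvPolynomial.zeroLocus K (MvPolynomial.vanishingIdeal K (torusTrace V p.1))) :
    q.2 ∈ MvPolynomial.zeroLocus K (MvPolynomial.vanishingIdeal K (torusTrace V q.1)) := by
  intro g hg
  obtain ⟨b, hb, hcl⟩ := exists_clearsDenominators (transition p.1.1 q.1.1) g
  have hmem : substitution (transition p.1.1 q.1.1) b g ∈
      MvPolynomial.vanishingIdeal K (torusTrace V p.1) := by
    intro x hx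
    have h0 := hg _ (monomialMap_transition_mem_torusTrace (M' := q.1) hx)
    rw [MvPolynomial.aeval_eq_eval] at h0 ⊢
    rw [eval_substitution hb hcl (regularAt_of_ne_zero (torusTrace_ne_zero hx) _)]
    exact mul_eq_zero_of_right _ h0
  have h1 := hp _ hmem
  rw [MvPolynomial.aeval_eq_eval] at h1 ⊢
  rw [eval_substitution hb hcl h.1, h.2.2] at h1
  exact (mul_eq_zero.mp h1).resolve_left (prod_pow_ne_zero hb h.1)

theorem chart_mem_strictTransform_iff {V : Set (Fin n → K)} {M : MaxCone F} {x : Fin n → K} :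
    chart K M x ∈ strictTransform F V ↔
      x ∈ MvPolynomial.zeroLocus K (MvPolynomial.vanishingIdeal K (torusTrace V M)) := by
  constructor
  · intro h
    -- The chartwise closures, glued together; the condition ranges over all representatives of a
    -- point.
    let Z : Set (ToricVariety K F) := {z | ∀ M x, z = chart K M x →
      x ∈ MvPolynomial.zeroLocus K (MvPolynomial.vanishingIdeal K (torusTrace V M))}
    refine Set.mem_sInter.mp h Z ⟨fun M' => ?_, ?_⟩ M x rfl
    · refine ⟨MvPolynomial.vanishingIdeal K (torusTrace V M'), Set.ext fun y => ⟨fun hy => ?_,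
        fun hy M'' y' heq => ?_⟩⟩
      · intro p hp
        simpa [MvPolynomial.aeval_eq_eval] using hy M' y rfl p hp
      · refine glue_mem_zeroLocus (p := (M', y)) (q := (M'', y')) (Quotient.exact heq) ?_
        intro p hp
        simpa [MvPolynomial.aeval_eq_eval] using hy p hp
    · rintro z hz M' y rfl
      exact MvPolynomial.zeroLocus_vanishingIdeal_le _ hz
  · intro hx
    rintro Z ⟨hZ, hsub⟩
    obtain ⟨S, hS⟩ := hZ M
    have : x ∈ chart K M ⁻¹' Z := by
      rw [hS]
      intro p hp
      have hpv : p ∈ MvPolynomial.vanishingIdeal K (torusTrace V M) := by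
        intro y hy
        have hyZ : y ∈ chart K M ⁻¹' Z := hsub hy
        rw [hS] at hyZ
        simpa [MvPolynomial.aeval_eq_eval] using hyZ p hp
      simpa [MvPolynomial.aeval_eq_eval] using hx p hpv
    exact this

end Charts

/-! ### Weights from points in the closure of a subset of the torus -/

section Valuation

/-- A valuation with support `Q` whose ring contains the whole ring and whose centre contains a
given proper ideal above `Q`. -/
theorem exists_valuation_lt_one.{u} {A : Type u} [CommRing A] {Q m : Ideal A} [Q.IsPrime]
    (hQ : Q ≤ m) (hm : m ≠ ⊤) :
    ∃ (Γ : Type u) (_ : LinearOrderedCommGroupWithZero Γ) (v : Valuation A Γ),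
      (∀ a, v a ≤ 1) ∧ (∀ a ∈ m, v a < 1) ∧ ∀ a, v a = 0 ↔ a ∈ Q := by
  let ψ : A →+* FractionRing (A ⧸ Q) :=
    (algebraMap (A ⧸ Q) (FractionRing (A ⧸ Q))).comp (Ideal.Quotient.mk Q)
  have hψ : ∀ a, ψ a = 0 ↔ a ∈ Q := fun a => by
    rw [← Ideal.Quotient.eq_zero_iff_mem]
    exact map_eq_zero_iff _ (IsFractionRing.injective (A ⧸ Q) (FractionRing (A ⧸ Q)))
  have hsurj : Function.Surjective ψ.rangeRestrict := ψ.rangeRestrict_surjective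
  have hne : m.map ψ.rangeRestrict ≠ ⊤ := by
    intro htop
    obtain ⟨a, ha, h1⟩ := (Ideal.mem_map_iff_of_surjective _ hsurj).mp
      ((Ideal.eq_top_iff_one _).mp htop)
    have h2 : ψ a = 1 := congrArg Subtype.val h1
    have h3 : a - 1 ∈ Q := (hψ _).mp (by rw [map_sub, h2, map_one, sub_self])
    exact hm ((Ideal.eq_top_iff_one _).mpr (by simpa using m.sub_mem ha (hQ h3)))
  -- A valuation ring of Frac(A/Q) that contains the image of A and has the image of m among its
  -- nonunits.
  obtain ⟨B, hB, hmB⟩ := Ideal.image_subset_nonunits_valuationSubring _ hne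
  refine ⟨B.ValueGroup, inferInstance, B.valuation.comap ψ, fun a => ?_, fun a ha => ?_,
    fun a => ?_⟩
  · exact (B.valuation_le_one_iff _).mpr (hB ⟨a, rfl⟩)
  · exact B.mem_nonunits_iff.mp (hmB ⟨ψ.rangeRestrict a, Ideal.mem_map_of_mem _ ha, rfl⟩)
  · rw [Valuation.comap_apply, map_eq_zero, hψ]

variable {K : Type*} [Field K] {n : ℕ}

theorem valuation_monomial {Γ : Type*} [LinearOrderedCommGroupWithZero Γ]
    {v : Valuation (MvPolynomial (Fin n) K) Γ} (hC : ∀ c : K, c ≠ 0 → v (MvPolynomial.C c) = 1)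
    (a : Fin n →₀ ℕ) {c : K} (hc : c ≠ 0) :
    v (MvPolynomial.monomial a c) = ∏ i, v (MvPolynomial.X i) ^ a i := by
  rw [MvPolynomial.monomial_eq, map_mul, hC c hc, one_mul,
    Finsupp.prod_fintype _ _ fun i => pow_zero _, map_prod]
  exact Finset.prod_congr rfl fun i _ => map_pow _ _ _

/-- The leading term has strictly larger value than every other term, so by the ultrametric
inequality it determines the value of g. -/
theorem HasLeadingMonomial.valuation_ne_zero {Γ : Type*} [LinearOrderedCommGroupWithZero Γ]
    {v : Valuation (MvPolynomial (Fin n) K) Γ} (hC : ∀ c : K, c ≠ 0 → v (MvPolynomial.C c) = 1)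
    (hX : ∀ i, v (MvPolynomial.X i) ≠ 0) {w : Fin n → ℝ}
    (hw : ∀ a b : Fin n → ℕ, ∑ i, w i * a i < ∑ i, w i * b i →
      ∏ i, v (MvPolynomial.X i) ^ b i < ∏ i, v (MvPolynomial.X i) ^ a i)
    {g : MvPolynomial (Fin n) K} {α : Fin n →₀ ℕ} (hg : HasLeadingMonomial w g α) :
    v g ≠ 0 := by
  classical
  have hα : α ∈ g.support := MvPolynomial.mem_support_iff.mpr hg.1
  have hne : v (MvPolynomial.monomial α (g.coeff α)) ≠ 0 := by
    rw [valuation_monomial hC α hg.1]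
    exact Finset.prod_ne_zero_iff.mpr fun i _ => pow_ne_zero _ (hX i)
  rw [g.as_sum, ← Finset.add_sum_erase _ _ hα, Valuation.map_add_eq_of_lt_left]
  · exact hne
  · refine v.map_sum_lt hne fun a ha => ?_
    obtain ⟨haα, ha⟩ := Finset.mem_erase.mp ha
    rw [valuation_monomial hC α hg.1,
      valuation_monomial hC a (MvPolynomial.mem_support_iff.mp ha)]
    exact hw α a (hg.2 a ha haα)

/-- If `x` is a zero of an ideal `J` modulo which the coordinates are not zero divisors, then
there is a weight that is positive at the vanishing coordinates of `x`, zero at the others, and for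
which no element of `J` has a monomial as its initial form. -/
theorem exists_weight_of_mem_zeroLocus {J : Ideal (MvPolynomial (Fin n) K)}
    (hJ : ∀ (g : MvPolynomial (Fin n) K) (N : ℕ),
      g * (∏ i, MvPolynomial.X i) ^ N ∈ J → g ∈ J)
    {x : Fin n → K} (hx : x ∈ MvPolynomial.zeroLocus K J) :
    ∃ w : Fin n → ℝ, (∀ i, x i = 0 → 0 < w i) ∧ (∀ i, x i ≠ 0 → w i = 0) ∧
      ∀ g ∈ J, ∀ α, ¬ HasLeadingMonomial w g α := by
  let m : Ideal (MvPolynomial (Fin n) K) := RingHom.ker (MvPolynomial.eval x)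
  have hmem : ∀ g, g ∈ m ↔ MvPolynomial.eval x g = 0 := fun g => RingHom.mem_ker
  have hmp : m.IsPrime := RingHom.ker_isPrime _
  obtain ⟨Q, hQ, hJQ, hQm, hhQ, hpow⟩ := exists_prime_forall_pow_mem
    (J := J) (m := m) (h := ∏ i, MvPolynomial.X i) fun g hg N hgN => hg <| by
      rw [hmem, ← MvPolynomial.aeval_eq_eval]
      exact hx g (hJ g N hgN)
  obtain ⟨Γ, _, v, hv1, hvm, hv0⟩ := exists_valuation_lt_one hQm hmp.ne_top
  have hC : ∀ c : K, c ≠ 0 → v (MvPolynomial.C c) = 1 := fun c hc => by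
    refine le_antisymm (hv1 _) ?_
    have h1 : v (MvPolynomial.C c) * v (MvPolynomial.C c⁻¹) = 1 := by
      rw [← map_mul, ← MvPolynomial.C_mul, mul_inv_cancel₀ hc, MvPolynomial.C_1, map_one]
    rw [← h1]
    exact mul_le_of_le_one_right' (hv1 _)
  -- Such a g is a nonzero constant, of value 1, plus an element of m, of value less than 1.
  have hunit : ∀ g, g ∉ m → v g = 1 := fun g hg => by
    have hg' : MvPolynomial.eval x g ≠ 0 := hg
    have h1 : g - MvPolynomial.C (MvPolynomial.eval x g) ∈ m := by simp [hmem]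
    rw [← add_sub_cancel (MvPolynomial.C (MvPolynomial.eval x g)) g,
      Valuation.map_add_eq_of_lt_left, hC _ hg']
    rw [hC _ hg']
    exact hvm _ h1
  have hXm : ∀ i, MvPolynomial.X i ∈ m ↔ x i = 0 := fun i => by simp [hmem]
  have hX0 : ∀ i, v (MvPolynomial.X i) ≠ 0 := fun i h0 =>
    hhQ (Q.mem_of_dvd (Finset.dvd_prod_of_mem _ (Finset.mem_univ i)) ((hv0 _).mp h0))
  obtain ⟨w, hwpos, hwzero, hw⟩ := exists_real_weight hX0 (fun i => hv1 _) fun i hi => by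
    have him : MvPolynomial.X i ∈ m := by
      by_contra hnot
      exact hi.ne (hunit _ hnot)
    obtain ⟨g, hg, N, hgN⟩ := hpow _ him
    -- Here g has value 1 and b has value 0, so g X_i^N = a h + b bounds the N-th power of the value
    -- of X_i by the value of h.
    obtain ⟨a, b, hb, hab⟩ := Ideal.mem_span_singleton_sup.mp hgN
    refine ⟨N, ?_⟩
    rw [← map_pow, ← map_prod, ← one_mul (v _), ← hunit g hg, ← map_mul, ← hab]
    refine (v.map_add _ _).trans (max_le ?_ ?_)
    · rw [map_mul]
      exact mul_le_of_le_one_left' (hv1 a)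
    · rw [(hv0 b).mpr hb]
      exact zero_le
  refine ⟨w, fun i hi => hwpos i (hvm _ ((hXm i).mpr hi)),
    fun i hi => hwzero i (hunit _ fun h => hi ((hXm i).mp h)), fun g hg α hlead => ?_⟩
  exact hlead.valuation_ne_zero hC hX0 hw ((hv0 g).mpr (hJQ hg))

end Valuation

/-! ### Cones of a regular fan subdividing the orthant -/

section Fans

variable {n : ℕ}

theorem mem_coneGen_subtype_iff {u : Fin n → Fin n → ℝ} {s : Finset (Fin n)} {x : Fin n → ℝ} :
    x ∈ coneGen (fun j : s => u j) ↔
      ∃ c : Fin n → ℝ, (∀ i, 0 ≤ c i) ∧ (∀ i ∉ s, c i = 0) ∧ x = ∑ i, c i • u i := by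
  classical
  have hsum : ∀ c : Fin n → ℝ, (∀ i ∉ s, c i = 0) →
      ∑ j : s, c j • u j = ∑ i, c i • u i := fun c hc => by
    rw [Finset.sum_coe_sort s fun i => c i • u i]
    exact Finset.sum_subset (Finset.subset_univ s) fun i _ hi => by rw [hc i hi, zero_smul]
  constructor
  · rintro ⟨c, hc, rfl⟩
    refine ⟨fun i => if h : i ∈ s then c ⟨i, h⟩ else 0, fun i => ?_, fun i hi => dif_neg hi, ?_⟩
    · dsimp only
      split_ifs with h
      · exact hc _
      · exact le_rfl
    · rw [← hsum _ fun i hi => dif_neg hi]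
      exact Finset.sum_congr rfl fun j _ => by rw [dif_pos j.2]
  · rintro ⟨c, hc, hcs, rfl⟩
    exact ⟨fun j => c j, fun j => hc j, (hsum c hcs).symm⟩

theorem mem_coneGen_self {ι : Type} [Fintype ι] (u : ι → Fin n → ℝ) (i : ι) :
    u i ∈ coneGen u := by
  classical
  exact ⟨Pi.single i 1, fun j => by by_cases h : j = i <;> simp [h], by simp [Pi.single_apply]⟩

theorem dotProduct_sum_smul {ι : Type} [Fintype ι] (v : Fin n → ℝ) (c : ι → ℝ)
    (u : ι → Fin n → ℝ) : v ⬝ᵥ ∑ i, c i • u i = ∑ i, c i * (v ⬝ᵥ u i) := by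
  rw [dotProduct_sum]
  exact Finset.sum_congr rfl fun i _ => by rw [dotProduct_smul, smul_eq_mul]

/-- A face of a cone that contains a positive combination of the generators is the whole cone. -/
theorem IsFace.eq_of_mem {ι : Type} [Fintype ι] {u : ι → Fin n → ℝ} {ρ : Set (Fin n → ℝ)}
    (h : IsFace ρ (coneGen u)) {c : ι → ℝ} (hc : ∀ i, 0 < c i) (hmem : ∑ i, c i • u i ∈ ρ) :
    ρ = coneGen u := by
  obtain ⟨v, hv, rfl⟩ := h
  have h0 : ∑ i, c i * (v ⬝ᵥ u i) = 0 := by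
    rw [← dotProduct_sum_smul]
    exact hmem.2
  have hnn : ∀ i, 0 ≤ v ⬝ᵥ u i := fun i => hv _ (mem_coneGen_self u i)
  have hz : ∀ i, v ⬝ᵥ u i = 0 := fun i =>
    (mul_eq_zero.mp ((Finset.sum_eq_zero_iff_of_nonneg fun i _ =>
      mul_nonneg (hc i).le (hnn i)).mp h0 i (Finset.mem_univ i))).resolve_left (hc i).ne'
  refine Set.Subset.antisymm (fun x hx => hx.1) fun x hx => ⟨hx, ?_⟩
  obtain ⟨d, -, rfl⟩ := hx
  rw [dotProduct_sum_smul]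
  exact Finset.sum_eq_zero fun i _ => by rw [hz i, mul_zero]

/-- A face of a cone on `n` generators is generated by some of them. -/
theorem IsFace.exists_eq_coneGen {u : Fin n → Fin n → ℝ} {τ : Set (Fin n → ℝ)}
    (h : IsFace τ (coneGen u)) :
    ∃ s : Finset (Fin n), τ = coneGen (fun j : s => u j) := by
  classical
  obtain ⟨v, hv, rfl⟩ := h
  have hnn : ∀ i, 0 ≤ v ⬝ᵥ u i := fun i => hv _ (mem_coneGen_self u i)
  refine ⟨Finset.univ.filter fun i => v ⬝ᵥ u i = 0, Set.ext fun x => ?_⟩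
  rw [mem_coneGen_subtype_iff]
  simp only [Finset.mem_filter, Finset.mem_univ, true_and]
  constructor
  · rintro ⟨⟨c, hc, rfl⟩, h0⟩
    rw [dotProduct_sum_smul] at h0
    refine ⟨c, hc, fun i hi => ?_, rfl⟩
    exact (mul_eq_zero.mp ((Finset.sum_eq_zero_iff_of_nonneg fun i _ =>
      mul_nonneg (hc i) (hnn i)).mp h0 i (Finset.mem_univ i))).resolve_right hi
  · rintro ⟨c, hc, hcs, rfl⟩
    refine ⟨⟨c, hc, rfl⟩, ?_⟩
    rw [dotProduct_sum_smul]
    refine Finset.sum_eq_zero fun i _ => ?_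
    by_cases hi : v ⬝ᵥ u i = 0
    · rw [hi, mul_zero]
    · rw [hcs i hi, zero_mul]

/-- When the cone spans the space, its generators form a basis of the whole lattice, so there are n
of them and they are the columns of a unimodular matrix. -/
theorem IsRegularCone.exists_eq_coneGen_column {σ : Set (Fin n → ℝ)} (h : IsRegularCone σ)
    (htop : Submodule.span ℝ σ = ⊤) : ∃ M : GL (Fin n) ℤ, σ = coneGen (column M) := by
  obtain ⟨k, u, hσ, hli, hspan⟩ := h
  have hsp : ⊤ ≤ Submodule.span ℤ (Set.range u) := fun v _ =>
    (hspan v).mp (by rw [htop]; exact Submodule.mem_top)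
  let b := Module.Basis.mk hli hsp
  obtain rfl : k = n := by
    simpa using Fintype.card_congr (b.indexEquiv (Pi.basisFun ℤ (Fin n)))
  refine ⟨⟨(Pi.basisFun ℤ (Fin k)).toMatrix b, b.toMatrix (Pi.basisFun ℤ (Fin k)),
    (Pi.basisFun ℤ (Fin k)).toMatrix_mul_toMatrix_flip b,
    b.toMatrix_mul_toMatrix_flip (Pi.basisFun ℤ (Fin k))⟩, ?_⟩
  rw [hσ]
  congr 1
  funext j
  unfold column
  congr 1
  funext i
  simp [Module.Basis.toMatrix_apply, b]

theorem sum_inv_mul_column (M : GL (Fin n) ℤ) (c : Fin n → ℝ) (j : Fin n) :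
    ∑ i, ((M⁻¹).val j i : ℝ) * (∑ k, c k • column M k) i = c j := by
  have h : ∀ k, ∑ i, ((M⁻¹).val j i : ℝ) * (M.val i k : ℝ) = if j = k then 1 else 0 := fun k => by
    have h1 : ((M⁻¹).val * M.val) j k = (1 : Matrix (Fin n) (Fin n) ℤ) j k := by
      rw [Units.inv_mul]
    rw [Matrix.mul_apply, Matrix.one_apply] at h1
    exact_mod_cast congrArg (fun z : ℤ => (z : ℝ)) h1
  simp only [Finset.sum_apply, Pi.smul_apply, column, toReal, smul_eq_mul, Finset.mul_sum]
  rw [Finset.sum_comm]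
  calc ∑ k, ∑ i, ((M⁻¹).val j i : ℝ) * (c k * (M.val i k : ℝ))
      = ∑ k, c k * ∑ i, ((M⁻¹).val j i : ℝ) * (M.val i k : ℝ) := by
        refine Finset.sum_congr rfl fun k _ => ?_
        rw [Finset.mul_sum]
        exact Finset.sum_congr rfl fun i _ => by ring
    _ = c j := by
        simp only [h]
        simp

theorem sum_column_inv_mul (M : GL (Fin n) ℤ) (x : Fin n → ℝ) :
    ∑ j, (∑ i, ((M⁻¹).val j i : ℝ) * x i) • column M j = x := by
  have h : ∀ i k, ∑ j, (M.val i j : ℝ) * ((M⁻¹).val j k : ℝ) = if i = k then 1 else 0 :=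
    fun i k => by
      have h1 : (M.val * (M⁻¹).val) i k = (1 : Matrix (Fin n) (Fin n) ℤ) i k := by
        rw [Units.mul_inv]
      rw [Matrix.mul_apply, Matrix.one_apply] at h1
      exact_mod_cast congrArg (fun z : ℤ => (z : ℝ)) h1
  funext i
  simp only [Finset.sum_apply, Pi.smul_apply, column, toReal, smul_eq_mul, Finset.sum_mul]
  rw [Finset.sum_comm]
  calc ∑ k, ∑ j, ((M⁻¹).val j k : ℝ) * x k * (M.val i j : ℝ)
      = ∑ k, x k * ∑ j, (M.val i j : ℝ) * ((M⁻¹).val j k : ℝ) := by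
        refine Finset.sum_congr rfl fun k _ => ?_
        rw [Finset.mul_sum]
        exact Finset.sum_congr rfl fun j _ => by ring
    _ = x i := by
        simp only [h]
        simp

theorem isClosed_coneGen_column (M : GL (Fin n) ℤ) : IsClosed (coneGen (column M)) := by
  have : coneGen (column M) = ⋂ j, {x | 0 ≤ ∑ i, ((M⁻¹).val j i : ℝ) * x i} := by
    ext x
    simp only [Set.mem_iInter]
    constructor
    · rintro ⟨c, hc, rfl⟩ j
      rw [Set.mem_ofPred_eq, sum_inv_mul_column]
      exact hc j
    · intro h
      exact ⟨_, h, (sum_column_inv_mul M x).symm⟩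
  rw [this]
  exact isClosed_iInter fun j => isClosed_le continuous_const (by fun_prop)

theorem mem_closure_interior_orthant {x : Fin n → ℝ} (hx : x ∈ orthant n) :
    x ∈ closure (Set.univ.pi fun _ : Fin n => Set.Ioi (0 : ℝ)) := by
  rw [closure_pi_set]
  intro i _
  rw [closure_Ioi]
  exact hx i

/-- A regular fan with support the orthant covers it by its cones of maximal dimension. -/
theorem exists_maxCone_mem (F : RegularFan n) (hF : orthant n ⊆ ⋃₀ F.cones) {x : Fin n → ℝ}
    (hx : x ∈ orthant n) : ∃ M : MaxCone F, x ∈ coneGen (column M.1) := by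
  let T : Set (Set (Fin n → ℝ)) := {σ ∈ F.cones | Submodule.span ℝ σ = ⊤}
  let B : Set (Set (Fin n → ℝ)) := {σ ∈ F.cones | Submodule.span ℝ σ ≠ ⊤}
  have hTfin : T.Finite := F.finite.subset fun σ hσ => hσ.1
  have hBfin : B.Finite := F.finite.subset fun σ hσ => hσ.1
  have hclosed : IsClosed (⋃ σ ∈ T, σ) := hTfin.isClosed_biUnion fun σ hσ => by
    obtain ⟨M, rfl⟩ := (F.regular σ hσ.1).exists_eq_coneGen_column hσ.2
    exact isClosed_coneGen_column M
  -- The spans of the lower-dimensional cones form a null set, so points in full-dimensional cones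
  -- are dense in the orthant; finitely many closed cones then cover it.
  have hnull : MeasureTheory.volume (⋃ σ ∈ B, (Submodule.span ℝ σ : Set (Fin n → ℝ))) = 0 :=
    (MeasureTheory.measure_biUnion_null_iff hBfin.countable).mpr fun σ hσ =>
      MeasureTheory.Measure.addHaar_submodule _ _ hσ.2
  have hopen : IsOpen (Set.univ.pi fun _ : Fin n => Set.Ioi (0 : ℝ)) :=
    isOpen_set_pi Set.finite_univ fun _ _ => isOpen_Ioi
  have hmem : x ∈ ⋃ σ ∈ T, σ := by
    refine hclosed.closure_subset (mem_closure_iff.mpr fun U hU hxU => ?_)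
    obtain ⟨y, hyU, hy⟩ := mem_closure_iff.mp (mem_closure_interior_orthant hx) U hU hxU
    have hpos := (hU.inter hopen).measure_pos MeasureTheory.volume ⟨y, hyU, hy⟩
    have hns : ¬ U ∩ (Set.univ.pi fun _ : Fin n => Set.Ioi (0 : ℝ)) ⊆
        ⋃ σ ∈ B, (Submodule.span ℝ σ : Set (Fin n → ℝ)) := fun hsub =>
      hpos.ne' (MeasureTheory.measure_mono_null hsub hnull)
    obtain ⟨z, ⟨hzU, hz⟩, hzB⟩ := Set.not_subset.mp hns
    obtain ⟨σ, hσ, hzσ⟩ := hF fun i => (Set.mem_Ioi.mp (hz i (Set.mem_univ i))).le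
    refine ⟨z, hzU, Set.mem_biUnion (x := σ) ⟨hσ, ?_⟩ hzσ⟩
    by_contra hne
    exact hzB (Set.mem_biUnion (x := σ) ⟨hσ, hne⟩ (Submodule.subset_span hzσ))
  obtain ⟨σ, ⟨hσ, htop⟩, hxσ⟩ := Set.mem_iUnion₂.mp hmem
  obtain ⟨M, rfl⟩ := (F.regular σ hσ).exists_eq_coneGen_column htop
  exact ⟨⟨M, hσ⟩, hxσ⟩

/-- Every cone of a regular fan with support the orthant is a face of a cone of maximal
dimension. -/
theorem exists_maxCone_face (F : RegularFan n) (hF : orthant n ⊆ ⋃₀ F.cones)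
    {τ : Set (Fin n → ℝ)} (hτ : τ ∈ F.cones) :
    ∃ (M : MaxCone F) (s : Finset (Fin n)), τ = coneGen (fun j : s => column M.1 j) := by
  obtain ⟨k, u, hu, -, -⟩ := F.regular τ hτ
  -- The sum of the generators is relatively interior in τ. A maximal cone containing it meets τ in
  -- a face of τ through this point, which is τ itself.
  let w : Fin n → ℝ := ∑ i, (1 : ℝ) • toReal (u i)
  have hwτ : w ∈ τ := by
    rw [hu]
    exact ⟨fun _ => 1, fun _ => zero_le_one, rfl⟩
  obtain ⟨M, hM⟩ := exists_maxCone_mem F hF (F.subset_orthant τ hτ hwτ)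
  obtain ⟨h1, h2⟩ := F.inter_face _ M.2 τ hτ
  have heq : coneGen (column M.1) ∩ τ = τ := by
    conv_rhs => rw [hu]
    refine IsFace.eq_of_mem (c := fun _ => 1) ?_ (fun _ => one_pos) ⟨hM, hwτ⟩
    rw [← hu]
    exact h2
  rw [heq] at h1
  exact ⟨M, h1.exists_eq_coneGen⟩

theorem coordCone_univ : coordCone (Finset.univ : Finset (Fin n)) = orthant n := by
  ext x
  rw [coordCone, mem_coneGen_subtype_iff (u := fun i => (Pi.single i 1 : Fin n → ℝ))]
  constructor
  · rintro ⟨c, hc, -, rfl⟩ i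
    rw [← pi_eq_sum_univ' c]
    exact hc i
  · intro hx
    exact ⟨x, hx, by simp, pi_eq_sum_univ' x⟩

variable {K : Type*} [Field K]

/-- The choice J = {1, …, n} puts C_w(I) ∩ orthant in the Gröbner fan, and this set contains w. In
particular the refinement covers the orthant. -/
theorem exists_cone_subset_groebnerCone {I : Ideal (MvPolynomial (Fin n) K)} {F : RegularFan n}
    (hF : IsRefinement F.cones (groebnerFan I)) {w : Fin n → ℝ} (hw : w ∈ orthant n) :
    ∃ σ ∈ F.cones, w ∈ σ ∧ σ ⊆ groebnerCone I w := by
  obtain ⟨S, hS, heq⟩ := hF _ ⟨w, Finset.univ, rfl⟩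
  have hmem : w ∈ groebnerCone I w ∩ coordCone Finset.univ :=
    ⟨subset_closure rfl, by rwa [coordCone_univ]⟩
  rw [heq] at hmem
  obtain ⟨σ, hσ, hwσ⟩ := hmem
  refine ⟨σ, hS hσ, hwσ, fun y hy => ?_⟩
  have : y ∈ groebnerCone I w ∩ coordCone Finset.univ := by
    rw [heq]
    exact ⟨σ, hσ, hy⟩
  exact this.1

/-- A cone of a refinement of the Gröbner fan with a relatively interior point in the tropical
variety is contained in it. -/
theorem coneGen_subset_tropicalVariety {I : Ideal (MvPolynomial (Fin n) K)} {F : RegularFan n}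
    (hF : IsRefinement F.cones (groebnerFan I)) {ι : Type} [Fintype ι] {u : ι → Fin n → ℝ}
    (hu : coneGen u ∈ F.cones) {c : ι → ℝ} (hc : ∀ i, 0 < c i)
    (hw : ∑ i, c i • u i ∈ tropicalVariety I) : coneGen u ⊆ tropicalVariety I := by
  have hmem : ∑ i, c i • u i ∈ coneGen u := ⟨c, fun i => (hc i).le, rfl⟩
  obtain ⟨σ, hσ, hwσ, hsub⟩ :=
    exists_cone_subset_groebnerCone hF (F.subset_orthant _ hu hmem)
  have heq := (F.inter_face σ hσ _ hu).2.eq_of_mem hc ⟨hwσ, hmem⟩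
  rw [← heq]
  exact fun y hy => groebnerCone_subset_tropicalVariety hw (hsub hy.1)

end Fans

/-! ### Orbits met by the strict transform -/

section Main

variable {K : Type*} [Field K] {n : ℕ} {F : RegularFan n}

/-- All coordinates are nonzero on the trace, so its vanishing ideal is saturated with respect to
their product. -/
theorem mem_vanishingIdeal_torusTrace_of_mul {V : Set (Fin n → K)} {M : MaxCone F}
    (g : MvPolynomial (Fin n) K) (N : ℕ)
    (h : g * (∏ i, MvPolynomial.X i) ^ N ∈ MvPolynomial.vanishingIdeal K (torusTrace V M)) :
    g ∈ MvPolynomial.vanishingIdeal K (torusTrace V M) := by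
  intro y hy
  have h1 := h y hy
  rw [map_mul, map_pow, map_prod] at h1
  refine (mul_eq_zero.mp h1).resolve_right
    (pow_ne_zero _ (Finset.prod_ne_zero_iff.mpr fun i _ => ?_))
  rw [MvPolynomial.aeval_X]
  exact torusTrace_ne_zero hy i

theorem substitution_mem_vanishingIdeal_torusTrace {I : Ideal (MvPolynomial (Fin n) K)}
    {M : MaxCone F} {f : MvPolynomial (Fin n) K} (hf : f ∈ I) :
    substitution M.1.valᵀ 0 f ∈
      MvPolynomial.vanishingIdeal K (torusTrace (MvPolynomial.zeroLocus K I) M) := by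
  intro y hy
  have hN : ∀ i j, 0 ≤ M.1.valᵀ i j := fun i j => M.nonneg j i
  have h0 := hy.1 f hf
  rw [MvPolynomial.aeval_eq_eval] at h0 ⊢
  exact (eval_substitution (b := 0) (fun j hj => absurd rfl hj) (clearsDenominators_zero hN f)
    (regularAt_of_nonneg hN y)).trans (mul_eq_zero_of_right _ h0)

theorem sum_smul_column_apply (M : GL (Fin n) ℤ) (c : Fin n → ℝ) (i : Fin n) :
    (∑ j, c j • column M j) i = ∑ j, c j * (M.valᵀ j i : ℝ) := by
  simp [column, toReal]

/-- A point of the strict transform in a chart yields a point of the tropical variety with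
positive coordinates at the generators where the point vanishes. -/
theorem exists_mem_tropicalVariety_of_chart_mem {I : Ideal (MvPolynomial (Fin n) K)}
    {M : MaxCone F} {x : Fin n → K}
    (hx : chart K M x ∈ strictTransform F (MvPolynomial.zeroLocus K I)) :
    ∃ c : Fin n → ℝ, (∀ i, x i = 0 → 0 < c i) ∧ (∀ i, x i ≠ 0 → c i = 0) ∧
      ∑ i, c i • column M.1 i ∈ tropicalVariety I := by
  obtain ⟨c, hpos, hzero, hc⟩ := exists_weight_of_mem_zeroLocus
    mem_vanishingIdeal_torusTrace_of_mul (chart_mem_strictTransform_iff.mp hx)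
  refine ⟨c, hpos, hzero, ?_⟩
  by_contra hnot
  obtain ⟨f, hf, μ, hμ⟩ := notMem_tropicalVariety_iff.mp hnot
  exact hc _ (substitution_mem_vanishingIdeal_torusTrace hf) _
    (hμ.substitution (clearsDenominators_zero (fun i j => M.nonneg j i) f)
      (sum_smul_column_apply M.1 c))

theorem monomialMap_inv_mem_torusTrace {V : Set (Fin n → K)} {M : MaxCone F} {x : Fin n → K}
    (hx : x ∈ V) (hx0 : ∀ i, x i ≠ 0) :
    monomialMap (M.1⁻¹).valᵀ x ∈ torusTrace V M := by
  have heq : monomialMap M.1.valᵀ (monomialMap (M.1⁻¹).valᵀ x) = x := by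
    rw [monomialMap_mul (regularAt_of_ne_zero hx0 _)
      (regularAt_of_ne_zero (monomialMap_ne_zero hx0 _) _), ← Matrix.transpose_mul,
      Units.mul_inv, Matrix.transpose_one, monomialMap_one]
  exact ⟨by rwa [heq], by rwa [heq]⟩

theorem prod_X_pow_eq_monomial (s : Finset (Fin n)) (N : ℕ) :
    (∏ i ∈ s, MvPolynomial.X i) ^ N =
      MvPolynomial.monomial (N • ∑ i ∈ s, Finsupp.single i 1) (1 : K) := by
  have : ∏ i ∈ s, (MvPolynomial.X i : MvPolynomial (Fin n) K) =
      MvPolynomial.monomial (∑ i ∈ s, Finsupp.single i 1) (1 : K) := by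
    rw [MvPolynomial.monomial_sum_one]
    rfl
  rw [this, MvPolynomial.monomial_pow, one_pow]

variable [IsAlgClosed K]

/-- If a polynomial vanishing on the trace of `V(I)` in a chart has a leading monomial, then the
corresponding weight is not in the tropical variety. -/
theorem HasLeadingMonomial.notMem_tropicalVariety {I : Ideal (MvPolynomial (Fin n) K)}
    {M : MaxCone F} {g : MvPolynomial (Fin n) K} {c : Fin n → ℝ} {α : Fin n →₀ ℕ}
    (hg : HasLeadingMonomial c g α)
    (hmem : g ∈ MvPolynomial.vanishingIdeal K (torusTrace (MvPolynomial.zeroLocus K I) M)) :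
    ∑ i, c i • column M.1 i ∉ tropicalVariety I := by
  obtain ⟨b, hb, hcl⟩ := exists_clearsDenominators (M.1⁻¹).valᵀ g
  have hlead := hg.substitution (w := ∑ i, c i • column M.1 i) hcl fun i => by
    rw [← sum_inv_mul_column M.1 c i]
    exact Finset.sum_congr rfl fun j _ => mul_comm _ _
  have hX := prod_X_pow_eq_monomial (K := K) (Finset.univ : Finset (Fin n)) 1
  rw [pow_one] at hX
  have hlead' := hlead.mul (hX ▸ hasLeadingMonomial_monomial _ _ one_ne_zero)
  -- The pulled-back polynomial is known to vanish only at the torus points of V(I); the factor ∏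
  -- X_i takes care of the coordinate hyperplanes. Both this factor and the passage to a power in I
  -- preserve having a leading monomial.
  have hrad : ToricTropical.substitution (M.1⁻¹).valᵀ b g * ∏ i, MvPolynomial.X i ∈ I.radical := by
    rw [← MvPolynomial.vanishingIdeal_zeroLocus_eq_radical (K := K) I]
    intro x hx
    rw [MvPolynomial.aeval_eq_eval, map_mul, map_prod]
    simp only [MvPolynomial.eval_X]
    by_cases hx0 : ∀ i, x i ≠ 0
    · refine mul_eq_zero_of_left ?_ _
      have h0 := hmem _ (monomialMap_inv_mem_torusTrace (M := M) hx hx0)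
      rw [MvPolynomial.aeval_eq_eval] at h0
      exact (eval_substitution hb hcl (regularAt_of_ne_zero hx0 _)).trans
        (mul_eq_zero_of_right _ h0)
    · push Not at hx0
      obtain ⟨i, hi⟩ := hx0
      exact mul_eq_zero_of_right _ (Finset.prod_eq_zero (Finset.mem_univ i) hi)
  obtain ⟨k, hk⟩ := hrad
  exact notMem_tropicalVariety_iff.mpr ⟨_, hk, _, hlead'.pow k⟩

/-- If an algebraic set misses a coordinate stratum, then its ideal has an element whose leading
monomial for the weight of the stratum does not involve the vanishing coordinates. -/
theorem exists_hasLeadingMonomial_of_disjoint {J : Ideal (MvPolynomial (Fin n) K)}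
    {s : Finset (Fin n)}
    (h : ∀ x ∈ MvPolynomial.zeroLocus K J, ¬ ∀ i, x i = 0 ↔ i ∈ s) :
    ∃ g ∈ J, ∃ α, HasLeadingMonomial (fun i => if i ∈ s then (1 : ℝ) else 0) g α := by
  classical
  -- At a zero of J whose coordinates in s vanish, some other coordinate must vanish too, since the
  -- zero set of J misses the stratum.
  have hrad : ∏ i ∈ sᶜ, MvPolynomial.X i ∈
      (J ⊔ Ideal.span (MvPolynomial.X '' (s : Set (Fin n)))).radical := by
    rw [← MvPolynomial.vanishingIdeal_zeroLocus_eq_radical (K := K)]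
    intro x hx
    rw [map_prod]
    simp only [MvPolynomial.aeval_X]
    by_contra hne
    refine h x (fun p hp => hx p (Ideal.mem_sup_left hp)) fun i => ⟨fun h0 => ?_, fun hi => ?_⟩
    · by_contra his
      exact hne (Finset.prod_eq_zero (Finset.mem_compl.mpr his) h0)
    · simpa using hx (MvPolynomial.X i)
        (Ideal.mem_sup_right (Ideal.subset_span ⟨i, hi, rfl⟩))
  obtain ⟨N, hN⟩ := hrad
  rw [prod_X_pow_eq_monomial] at hN
  obtain ⟨g, hg, r, hr, hgr⟩ := Submodule.mem_sup.mp hN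
  rw [MvPolynomial.mem_ideal_span_X_image] at hr
  -- This exponent has weight 0, while every term of r contains a variable from s and has positive
  -- weight.
  let α : Fin n →₀ ℕ := N • ∑ i ∈ sᶜ, Finsupp.single i 1
  have hα : ∀ i ∈ s, α i = 0 := fun i hi => by
    simp only [α, Finsupp.smul_apply, Finsupp.finsetSum_apply]
    rw [Finset.sum_eq_zero, smul_zero]
    intro j hj
    rw [Finsupp.single_apply, if_neg]
    rintro rfl
    exact Finset.mem_compl.mp hj hi
  have hαw : weight (fun i => if i ∈ s then (1 : ℝ) else 0) α = 0 :=
    Finset.sum_eq_zero fun i _ => by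
      by_cases hi : i ∈ s <;> simp [hi, hα]
  have hgeq : g = MvPolynomial.monomial α 1 - r := eq_sub_of_add_eq hgr
  refine ⟨g, hg, α, ?_, fun ν hν hne => ?_⟩
  · have : r.coeff α = 0 := by
      by_contra h0
      obtain ⟨i, hi, hαi⟩ := hr α (MvPolynomial.mem_support_iff.mpr h0)
      exact hαi (hα i hi)
    simp [hgeq, this]
  · have hνr : ν ∈ r.support := by
      rw [MvPolynomial.mem_support_iff, hgeq, MvPolynomial.coeff_sub,
        MvPolynomial.coeff_monomial, if_neg (Ne.symm hne), zero_sub, neg_ne_zero] at hν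
      exact MvPolynomial.mem_support_iff.mpr hν
    obtain ⟨i, hi, hνi⟩ := hr ν hνr
    have hi' : i ∈ s := hi
    rw [hαw]
    refine Finset.sum_pos' (fun j _ => by dsimp only; split_ifs <;> simp) ⟨i, Finset.mem_univ i, ?_⟩
    dsimp only
    rw [if_pos hi', one_mul]
    exact_mod_cast Nat.pos_of_ne_zero hνi

end Main

end ToricTropical

end

theorem theorem13p2 {K : Type*} [Field K] [IsAlgClosed K] {n : ℕ}
    (I : Ideal (MvPolynomial (Fin n) K)) (F : ToricTropical.RegularFan n)
    (hF : ToricTropical.IsRefinement F.cones (ToricTropical.groebnerFan I))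
    (τ : Set (Fin n → ℝ)) (hτ : τ ∈ F.cones) :
    (ToricTropical.strictTransform F (MvPolynomial.zeroLocus K I) ∩
        ToricTropical.orbit K F τ).Nonempty ↔
      τ ⊆ ToricTropical.tropicalVariety I := by
  open ToricTropical in
  constructor
  · rintro ⟨_, hz, M, s, x, rfl, hxs, rfl⟩
    obtain ⟨c, hpos, hzero, hc⟩ := exists_mem_tropicalVariety_of_chart_mem hz
    -- The weights are positive on s and vanish elsewhere, so the point found is relatively interior
    -- in τ.
    refine coneGen_subset_tropicalVariety hF hτ (c := fun j : s => c j)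
      (fun j => hpos j ((hxs j).mpr j.2)) ?_
    rw [Finset.sum_coe_sort s fun j => c j • column M.1 j,
      Finset.sum_subset (Finset.subset_univ s) fun j _ hj => by
        rw [hzero j fun h0 => hj ((hxs j).mp h0), zero_smul]]
    exact hc
  · intro hsub
    have hsupp : orthant n ⊆ ⋃₀ F.cones := fun w hw => by
      obtain ⟨σ, hσ, hwσ, -⟩ := exists_cone_subset_groebnerCone hF hw
      exact ⟨σ, hσ, hwσ⟩
    obtain ⟨M, s, rfl⟩ := exists_maxCone_face F hsupp hτ
    by_contra hempty
    obtain ⟨g, hg, α, hα⟩ := exists_hasLeadingMonomial_of_disjoint (s := s)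
      (J := MvPolynomial.vanishingIdeal K (torusTrace (MvPolynomial.zeroLocus K I) M))
      fun x hx hxs => hempty ⟨chart K M x, chart_mem_strictTransform_iff.mpr hx,
        M, s, x, rfl, hxs, rfl⟩
    -- The indicator weight of s corresponds to the sum of the generators of τ, a point of τ and
    -- hence of the tropical variety.
    refine hα.notMem_tropicalVariety hg (hsub (mem_coneGen_subtype_iff.mpr
      ⟨_, fun i => ?_, fun i hi => if_neg hi, rfl⟩))
    split_ifs <;> simp
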